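/- **Proposition.** Let $\pi=(\pi_j)_{j\ge1}$ be a decreasing sequence $\pi_1\ge\pi_2\ge\dots$ of positive numbers with $\pi_j\to0$ and $\sum_j\pi_j=\infty$. For a finitely supported real sequence $\xi$ with decreasing rearrangement $(\xi_j^*)_{j\ge1}$ of $(|\xi_j|)_{j\ge1}$, put $$\Phi_\pi(\xi)=\sum_{j\ge1}\pi_j\,\xi_j^*,\qquad \Phi_{\pi^*}(\xi)=\sup_{n\ge1}\frac{\sum_{1\le j\le n}\xi_j^*}{\sum_{1\le j\le n}\pi_j},$$ and let $\varphi=(\varphi(1),\varphi(2))=(\Phi_\pi,\Phi_{\pi^*})$. For a finite rank operator $T$ on a complex Hilbert space let $|T|_\Phi=\Phi(s_1,s_2,\dots)$, where $s_1,s_2,\dots$ are the eigenvalues of $(T^*T)^{1/2}$ repeated according to multiplicity (only finitely many are nonzero). For a pair $\tau=(\tau(1),\tau(2))$ of bounded operators on a Hilbert space $\mathcal H$ let $\|\tau\|=\max_j\|\tau(j)\|$ and $$k_\varphi(\tau)=\liminf_{A}\ \max_{j=1,2}\,\bigl|\tau(j)A-A\tau(j)\bigr|_{\varphi(j)}\in[0,\infty],$$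 the liminf being taken over the finite rank operators $A$ on $\mathcal H$ with $0\le A\le I$, directed by the usual order of hermitian operators. Then there is a constant $C$, depending only on $\pi$, such that for every separable infinite-dimensional complex Hilbert space $\mathcal H$ and every pair $\tau=(\tau(1),\tau(2))$ of commuting bounded hermitian operators on $\mathcal H$: 1. if $\tau$ has a cyclic vector (a vector $\xi$ such that the vectors $p(\tau(1),\tau(2))\xi$, $p$ a polynomial, are dense in $\mathcal H$), then $k_\varphi(\tau)\le C\|\tau\|$; 2. if the joint spectral measure of $\tau$ on $\mathbb R^2$ is singular with respect to Lebesgue measure, then $k_\varphi(\tau)=0$ (no cyclic vector is required here). -/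

import Mathlib

open scoped ENNReal CompactlySupported InnerProductSpace

universe u

noncomputable section

namespace HybridPerturbation

/-! ### Finitely supported sequences and Lorentz norming functions -/

/-- The finitely supported sequence listing the elements of a finite multiset of reals in
decreasing order (indices start at `0`), followed by zeros. -/
def decreasingList (s : Multiset ℝ) : ℕ →₀ ℝ :=
  (s.sort (fun a b => a ≥ b)).toFinsupp

/-- The decreasing rearrangement `ξ*` of `(|ξ_j|)_j`. -/
def decreasingRearrangement (ξ : ℕ →₀ ℝ) : ℕ →₀ ℝ :=
  decreasingList (ξ.support.val.map fun i => |ξ i|)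

/-- `Φ_π(ξ) = ∑_j π_j ξ*_j` (a finite sum); `w j` is the weight `π_{j+1}`. -/
def lorentzNorm (w : ℕ → ℝ) (ξ : ℕ →₀ ℝ) : ℝ :=
  (decreasingRearrangement ξ).sum fun j x => w j * x

/-- `Φ_{π*}(ξ) = sup_{n ≥ 1} (∑_{j ≤ n} ξ*_j) / (∑_{j ≤ n} π_j)`. -/
def dualLorentzNorm (w : ℕ → ℝ) (ξ : ℕ →₀ ℝ) : ℝ :=
  ⨆ n : ℕ, (∑ j ∈ Finset.range (n + 1), decreasingRearrangement ξ j) /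
    (∑ j ∈ Finset.range (n + 1), w j)

/-- The pair `φ = (Φ_π, Φ_{π*})`. -/
def lorentzPair (w : ℕ → ℝ) : Fin 2 → (ℕ →₀ ℝ) → ℝ :=
  ![lorentzNorm w, dualLorentzNorm w]

/-! ### The modulus of quasicentral approximation -/

variable {H : Type u} [NormedAddCommGroup H] [InnerProductSpace ℂ H] [CompleteSpace H]

/-- The multiset of nonzero eigenvalues of `(T*T)^{1/2}`, repeated according to multiplicity,
for an operator `T` of finite rank (in which case the sum has finitely many nonzero terms, all
multiplicities being finite). -/
def singularMultiset (T : H →L[ℂ] H) : Multiset ℝ :=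
  ∑ᶠ t : {t : ℝ // 0 < t},
    Multiset.replicate
      (Module.finrank ℂ (Module.End.eigenspace
        ((CFC.sqrt (star T * T) : H →L[ℂ] H) : Module.End ℂ H) ((t : ℝ) : ℂ))) (t : ℝ)

/-- The sequence of singular numbers of an operator of finite rank, in decreasing order. -/
def singularNumbers (T : H →L[ℂ] H) : ℕ →₀ ℝ :=
  decreasingList (singularMultiset T)

/-- `|T|_Φ = Φ(s_1, s_2, …)` for an operator `T` of finite rank. -/
def idealNorm (Φ : (ℕ →₀ ℝ) → ℝ) (T : H →L[ℂ] H) : ℝ≥0∞ :=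
  ENNReal.ofReal (Φ (singularNumbers T))

/-- `|τ|_φ = max_j |τ(j)|_{φ(j)}` for an `n`-tuple of operators of finite rank. -/
def hybridNorm {n : ℕ} (φ : Fin n → (ℕ →₀ ℝ) → ℝ) (τ : Fin n → H →L[ℂ] H) : ℝ≥0∞ :=
  ⨆ j, idealNorm (φ j) (τ j)

/-- The commutator `[τ, A]`, componentwise. -/
def tupleCommutator {n : ℕ} (τ : Fin n → H →L[ℂ] H) (A : H →L[ℂ] H) : Fin n → H →L[ℂ] H :=
  fun j => τ j * A - A * τ j

variable (H) in
/-- The positive contractions of finite rank, with the usual order of hermitian operators. -/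
abbrev FiniteRankContraction : Type u :=
  {A : H →L[ℂ] H // 0 ≤ A ∧ A ≤ 1 ∧ FiniteDimensional ℂ (LinearMap.range (A : H →ₗ[ℂ] H))}

/-- The modulus of quasicentral approximation
`k_φ(τ) = liminf_A |[τ, A]|_φ`, over the directed set of positive contractions of finite rank. -/
def quasicentralModulus {n : ℕ} (φ : Fin n → (ℕ →₀ ℝ) → ℝ) (τ : Fin n → H →L[ℂ] H) : ℝ≥0∞ :=
  Filter.liminf
    (fun A : FiniteRankContraction H => hybridNorm φ (tupleCommutator τ A.1)) Filter.atTop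

/-! ### Commuting hermitian tuples, cyclic vectors, spectral measures -/

/-- A tuple of pairwise commuting hermitian operators. -/
def IsCommutingHermitian {n : ℕ} (τ : Fin n → H →L[ℂ] H) : Prop :=
  (∀ j, IsSelfAdjoint (τ j)) ∧ ∀ i j, Commute (τ i) (τ j)

/-- `ξ` is cyclic for `τ`: the vectors `p(τ) ξ`, `p` a polynomial, are dense. -/
def IsCyclicVector {n : ℕ} (τ : Fin n → H →L[ℂ] H) (ξ : H) : Prop :=
  Dense {η : H | ∃ A ∈ Algebra.adjoin ℂ (Set.range τ), A ξ = η}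

/-- The continuous functional calculus `f(τ(1), τ(2))` of a commuting hermitian pair, for a
real function `f` of two real variables: the function `x + iy ↦ f(x, y)` of the normal operator
`τ(1) + iτ(2)`. -/
def pairCFC (τ : Fin 2 → H →L[ℂ] H) (f : (Fin 2 → ℝ) → ℝ) : H →L[ℂ] H :=
  cfc (fun z : ℂ => (f ![z.re, z.im] : ℂ)) (τ 0 + Complex.I • τ 1)

lemma continuous_pairCoord {f : (Fin 2 → ℝ) → ℝ} (hf : Continuous f) :
    Continuous (fun z : ℂ => (f ![z.re, z.im] : ℂ)) := by
  refine Complex.continuous_ofReal.comp (hf.comp ?_)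
  refine continuous_pi fun i => ?_
  fin_cases i
  · exact Complex.continuous_re
  · exact Complex.continuous_im

open scoped ComplexOrder in
/-- The positive linear functional `f ↦ ⟨f(τ) ξ, ξ⟩` on `C_c(ℝ²)`. -/
def spectralFunctional (τ : Fin 2 → H →L[ℂ] H) (ξ : H) : C_c(Fin 2 → ℝ, ℝ) →ₚ[ℝ] ℝ :=
  PositiveLinearMap.mk₀
    { toFun := fun f => (⟪ξ, pairCFC τ f ξ⟫_ℂ).re
      map_add' := by
        intro f g
        have h := cfc_add (a := τ 0 + Complex.I • τ 1)
          (fun z : ℂ => (f ![z.re, z.im] : ℂ)) (fun z : ℂ => (g ![z.re, z.im] : ℂ))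
          (continuous_pairCoord f.continuous).continuousOn
          (continuous_pairCoord g.continuous).continuousOn
        simp only [pairCFC, CompactlySupportedContinuousMap.coe_add, Pi.add_apply,
          Complex.ofReal_add]
        rw [h]
        simp
      map_smul' := by
        intro c f
        have h := cfc_const_mul (c : ℂ) (fun z : ℂ => (f ![z.re, z.im] : ℂ))
          (τ 0 + Complex.I • τ 1) (continuous_pairCoord f.continuous).continuousOn
        simp only [pairCFC, CompactlySupportedContinuousMap.coe_smul, Pi.smul_apply,
          smul_eq_mul, Complex.ofReal_mul]
        rw [h]
        simp }
    (by
      intro f hf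
      have h : 0 ≤ pairCFC τ f := by
        refine cfc_nonneg fun z _ => ?_
        exact Complex.zero_le_real.2 (hf ![z.re, z.im])
      exact ((ContinuousLinearMap.nonneg_iff_isPositive _).1 h).re_inner_nonneg_right ξ)

/-- The functional calculus sends the coordinate functions to the operators of the pair. -/
lemma pairCFC_coord {τ : Fin 2 → H →L[ℂ] H} (hτ : IsCommutingHermitian τ) (j : Fin 2) :
    pairCFC τ (fun x => x j) = τ j := by
  have h0 : star (τ 0) = τ 0 := hτ.1 0
  have h1 : star (τ 1) = τ 1 := hτ.1 1
  have hc : τ 0 * τ 1 = τ 1 * τ 0 := hτ.2 0 1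
  have hs : star (τ 0 + Complex.I • τ 1) = τ 0 - Complex.I • τ 1 := by
    rw [star_add, star_smul, h0, h1]
    simp [sub_eq_add_neg]
  have hN : IsStarNormal (τ 0 + Complex.I • τ 1) := by
    refine ⟨?_⟩
    rw [hs]
    change (_ - _) * (_ + _) = (_ + _) * (_ - _)
    simp only [mul_add, add_mul, sub_mul, mul_sub, smul_mul_assoc, mul_smul_comm, hc, smul_sub,
      smul_add, smul_smul]
    abel
  have hre : cfc (fun z : ℂ => (1 / 2 : ℂ) * (z + star z)) (τ 0 + Complex.I • τ 1) = τ 0 := by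
    rw [cfc_const_mul (1 / 2 : ℂ) (fun z : ℂ => z + star z) (τ 0 + Complex.I • τ 1)
        (by fun_prop),
      cfc_add (a := τ 0 + Complex.I • τ 1) (fun z : ℂ => z) (fun z : ℂ => star z)
        (by fun_prop) (by fun_prop),
      cfc_id' ℂ (τ 0 + Complex.I • τ 1), cfc_star_id (τ 0 + Complex.I • τ 1), hs,
      show τ 0 + Complex.I • τ 1 + (τ 0 - Complex.I • τ 1) = (2 : ℂ) • τ 0 by
        rw [two_smul]; abel, smul_smul]
    norm_num
  have him : cfc (fun z : ℂ => (-Complex.I / 2 : ℂ) * (z - star z)) (τ 0 + Complex.I • τ 1)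
      = τ 1 := by
    rw [cfc_const_mul (-Complex.I / 2 : ℂ) (fun z : ℂ => z - star z) (τ 0 + Complex.I • τ 1)
        (by fun_prop),
      cfc_sub (a := τ 0 + Complex.I • τ 1) (fun z : ℂ => z) (fun z : ℂ => star z)
        (by fun_prop) (by fun_prop),
      cfc_id' ℂ (τ 0 + Complex.I • τ 1), cfc_star_id (τ 0 + Complex.I • τ 1), hs,
      show τ 0 + Complex.I • τ 1 - (τ 0 - Complex.I • τ 1) = (2 * Complex.I : ℂ) • τ 1 by
        rw [mul_smul, two_smul]; abel, smul_smul,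
      show (-Complex.I / 2 : ℂ) * (2 * Complex.I) = 1 by
        linear_combination -Complex.I_mul_I]
    exact one_smul _ _
  fin_cases j
  · refine Eq.trans ?_ hre
    unfold pairCFC
    congr 1
    funext z
    apply Complex.ext <;> simp <;> ring
  · refine Eq.trans ?_ him
    unfold pairCFC
    congr 1
    funext z
    apply Complex.ext <;> simp <;> ring

/-- The scalar spectral measure `μ_ξ = ⟨E(·) ξ, ξ⟩` on `ℝ²` of the spectral measure `E` of a
commuting hermitian pair `τ`: the regular Borel measure with `∫ f dμ_ξ = ⟨f(τ) ξ, ξ⟩` for all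
`f ∈ C_c(ℝ²)`. -/
def scalarSpectralMeasure (τ : Fin 2 → H →L[ℂ] H) (ξ : H) : MeasureTheory.Measure (Fin 2 → ℝ) :=
  RealRMK.rieszMeasure (spectralFunctional τ ξ)

lemma integral_scalarSpectralMeasure (τ : Fin 2 → H →L[ℂ] H) (ξ : H) (f : C_c(Fin 2 → ℝ, ℝ)) :
    ∫ x, f x ∂(scalarSpectralMeasure τ ξ) = (⟪ξ, pairCFC τ f ξ⟫_ℂ).re :=
  RealRMK.integral_rieszMeasure _ f

/-- The spectral measure `E` of `τ` is singular with respect to Lebesgue measure on `ℝ²`: it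
vanishes off some Lebesgue null Borel set `N`. Here `E(Nᶜ) = 0` is expressed by
`⟨E(Nᶜ) ξ, ξ⟩ = 0` for all `ξ`. -/
def HasSingularSpectralMeasure (τ : Fin 2 → H →L[ℂ] H) : Prop :=
  ∃ N : Set (Fin 2 → ℝ), MeasurableSet N ∧ MeasureTheory.volume N = 0 ∧
    ∀ ξ : H, scalarSpectralMeasure τ ξ Nᶜ = 0

end HybridPerturbation

end

/-!
A Lorentz norm and its dual satisfy `Φ_π(1ⁿ) = S n` and `Φ_π*(1ⁿ) = n / S n`, where
`S n = w 0 + ⋯ + w (n - 1)`, so the product of the two norms of `n` ones is `n`. The joint spectrum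
is therefore cut not into squares but into rectangles: a grid with about `S n` columns and
`n / S n` rows has about `n` cells, and both numbers tend to infinity because `∑ w = ∞` and
`w → 0`. If `P` is a projection of rank about `n` which is a sum of projections onto subspaces of
the spectral subspaces of the cells, then `[τ(1), P]` has norm `O(1 / S n)` and `[τ(2), P]` has norm
`O(S n / n)`, both of rank `O(n)`, whence both ideal norms are bounded
(`norm_commutator_sumProjection_le`, `exists_ge_of_gridSize`).

* With a cyclic vector `ξ`, let `P` be the projection onto the span of the vectors `E(cell) ξ`.
  These projections fix `ξ` and commute asymptotically with `τ`, so they converge strongly to the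
  identity (`tendsto_of_isCyclicVector`).
* If the spectral measure is singular, it suffices to approximate finitely many given vectors, and
  up to a small error these are carried by a compact null set `L`. Only the cells meeting `L` are
  needed; their number is `o(n)` (`eventually_card_cell_le`), so the grid can be refined by any
  constant factor `κ` while the rank stays below `n`, and the bound becomes `O(1 / κ)`.

The liminf over the directed set of contractions requires `A ≥ A₀` for a given `A₀`. A projection
`P` that almost fixes the range of `A₀`, with range projection `Q`, is replaced by
`1 - (1 - Q)(1 - P)(1 - Q)`, which lies above `Q ≥ A₀` and differs from `P` by a small operator of
rank bounded in terms of `A₀` (`exists_ge_of_isStarProjection`). The ideal norms are estimated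
without the triangle inequality: if `‖X‖ ≤ δ` and `Y` has rank at most `m`, then `X + Y` has at most
`m` singular numbers above `δ` (`card_filter_singularMultiset_le`).

Spectral projections are needed for half-open boxes only. They are obtained as strong limits of the
continuous functional calculus, by dominated convergence for the scalar spectral measures
(`exists_isSpectralProjection`).
-/

set_option linter.unusedSectionVars false

noncomputable section

namespace HybridPerturbation

open scoped ENNReal CompactlySupported InnerProductSpace

/-! ### Decreasing rearrangements and Lorentz norms -/

section Rearrangement

lemma decreasingList_le_of_card_filter_le (t : Multiset ℝ) {δ : ℝ} (hδ : 0 ≤ δ) {m : ℕ}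
    (h : (t.filter (δ < ·)).card ≤ m) {j : ℕ} (hj : m ≤ j) : decreasingList t j ≤ δ := by
  unfold decreasingList
  rw [List.toFinsupp_apply]
  set l := t.sort (fun a b => a ≥ b) with hl
  have hlt : (l : Multiset ℝ) = t := Multiset.sort_eq _ _
  by_cases hjl : j < l.length
  · rw [List.getD_eq_getElem _ _ hjl]
    by_contra! hlt'
    have hs : l.Pairwise (fun a b => a ≥ b) := Multiset.pairwise_sort _ _
    have h1 : ∀ x ∈ l.take (j + 1), δ < x := by
      intro x hx
      obtain ⟨i, hi, rfl⟩ := List.mem_iff_getElem.1 hx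
      rw [List.length_take] at hi
      rw [List.getElem_take]
      rcases Nat.lt_or_ge i j with hij | hij
      · exact hlt'.trans_le ((List.pairwise_iff_getElem.1 hs) i j _ hjl hij)
      · have : i = j := by omega
        subst this
        exact hlt'
    have h2 : j + 1 ≤ (t.filter (δ < ·)).card := by
      rw [← hlt, Multiset.filter_coe, Multiset.coe_card]
      have h3 : ((l.take (j + 1)).filter (fun b => decide (δ < b))).length
          ≤ (l.filter (fun b => decide (δ < b))).length :=
        ((List.take_sublist (j + 1) l).filter _).length_le
      rw [List.filter_eq_self.2 (by simpa using h1)] at h3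
      rw [List.length_take] at h3
      omega
    omega
  · rw [List.getD_eq_default _ _ (by omega)]
    exact hδ

lemma decreasingList_nonneg {t : Multiset ℝ} (ht : ∀ x ∈ t, 0 ≤ x) (j : ℕ) :
    0 ≤ decreasingList t j := by
  unfold decreasingList
  rw [List.toFinsupp_apply]
  by_cases hjl : j < (t.sort (fun a b => a ≥ b)).length
  · rw [List.getD_eq_getElem _ _ hjl]
    exact ht _ ((Multiset.mem_sort _).1 (List.getElem_mem hjl))
  · rw [List.getD_eq_default _ _ (by omega)]

/-- Counting the terms above a threshold bounds the tail of the decreasing rearrangement. -/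
lemma decreasingRearrangement_decreasingList_le {t : Multiset ℝ} (ht : ∀ x ∈ t, 0 ≤ x) {δ : ℝ}
    (hδ : 0 ≤ δ) {m : ℕ} (h : (t.filter (δ < ·)).card ≤ m) {j : ℕ} (hj : m ≤ j) :
    decreasingRearrangement (decreasingList t) j ≤ δ := by
  refine decreasingList_le_of_card_filter_le _ hδ ?_ hj
  rw [Multiset.filter_map, Multiset.card_map]
  calc _ = ((decreasingList t).support.filter
        ((δ < ·) ∘ fun i => |decreasingList t i|)).card := rfl
    _ ≤ (Finset.range m).card := by
        refine Finset.card_le_card fun i hi => ?_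
        have h2 := (Finset.mem_filter.1 hi).2
        simp only [Function.comp_apply, abs_of_nonneg (decreasingList_nonneg ht i)] at h2
        rw [Finset.mem_range]
        by_contra! hmi
        exact absurd (decreasingList_le_of_card_filter_le t hδ h hmi) (not_le.2 h2)
    _ = m := Finset.card_range m

variable {w : ℕ → ℝ}

lemma sum_range_pos (hpos : ∀ j, 0 < w j) {n : ℕ} (hn : 0 < n) : 0 < ∑ j ∈ Finset.range n, w j :=
  Finset.sum_pos (fun j _ => hpos j) ⟨0, Finset.mem_range.2 hn⟩

lemma sum_range_mono (hpos : ∀ j, 0 < w j) {n r : ℕ} (hnr : n ≤ r) :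
    ∑ j ∈ Finset.range n, w j ≤ ∑ j ∈ Finset.range r, w j :=
  Finset.sum_le_sum_of_subset_of_nonneg (Finset.range_mono hnr) fun j _ _ => (hpos j).le

/-- The averages `S_n / n` of a decreasing sequence decrease. -/
lemma mul_sum_range_le (hanti : Antitone w) {n r : ℕ} (hnr : n ≤ r) :
    (n : ℝ) * ∑ j ∈ Finset.range r, w j ≤ r * ∑ j ∈ Finset.range n, w j := by
  have h1 : (n : ℝ) * w n ≤ ∑ j ∈ Finset.range n, w j := by
    have := Finset.card_nsmul_le_sum (Finset.range n) w (w n)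
      fun j hj => hanti (Finset.mem_range.1 hj).le
    simpa using this
  have h2 : ∑ j ∈ Finset.Ico n r, w j ≤ ((r : ℝ) - n) * w n := by
    have := Finset.sum_le_card_nsmul (Finset.Ico n r) w (w n)
      fun j hj => hanti (Finset.mem_Ico.1 hj).1
    simpa [Nat.cast_sub hnr] using this
  rw [← Finset.sum_range_add_sum_Ico _ hnr]
  have hnr' : (0 : ℝ) ≤ (r : ℝ) - n := by simpa using hnr
  nlinarith [mul_le_mul_of_nonneg_left h1 hnr', (Nat.cast_nonneg n : (0 : ℝ) ≤ n)]

/-- A sequence dominated by `M` on `m` places and by `δ` on `r` places. -/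
lemma lorentzNorm_le (hpos : ∀ j, 0 < w j) {ξ : ℕ →₀ ℝ} {M δ : ℝ} {m r : ℕ}
    (h : ∀ j, decreasingRearrangement ξ j ≤ (if j < m then M else 0) + (if j < r then δ else 0)) :
    lorentzNorm w ξ ≤ M * (∑ j ∈ Finset.range m, w j) + δ * ∑ j ∈ Finset.range r, w j := by
  set η := decreasingRearrangement ξ
  obtain ⟨L, hL⟩ : ∃ L, η.support ∪ Finset.range m ∪ Finset.range r ⊆ Finset.range L :=
    Finset.exists_nat_subset_range _
  have hLm := (Finset.subset_union_right.trans Finset.subset_union_left).trans hL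
  have hLr := Finset.subset_union_right.trans hL
  have hLη := (Finset.subset_union_left.trans Finset.subset_union_left).trans hL
  have key : ∀ (q : ℕ) (c : ℝ), Finset.range q ⊆ Finset.range L →
      ∑ j ∈ Finset.range L, w j * (if j < q then c else 0) = c * ∑ j ∈ Finset.range q, w j := by
    intro q c hq
    rw [← Finset.sum_subset hq, Finset.mul_sum]
    · refine Finset.sum_congr rfl fun j hj => ?_
      rw [if_pos (Finset.mem_range.1 hj), mul_comm]
    · intro j _ hj
      rw [if_neg (by simpa using hj), mul_zero]
  calc lorentzNorm w ξ = ∑ j ∈ Finset.range L, w j * η j :=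
        Finsupp.sum_of_support_subset _ hLη _ (by simp)
    _ ≤ ∑ j ∈ Finset.range L, w j * ((if j < m then M else 0) + (if j < r then δ else 0)) :=
        Finset.sum_le_sum fun j _ => mul_le_mul_of_nonneg_left (h j) (hpos j).le
    _ = _ := by
        simp only [mul_add, Finset.sum_add_distrib]
        rw [key m M hLm, key r δ hLr]

/-- The bound `M m / w 0` for the `m` large terms is crude, but these are multiplied by an
arbitrarily small `M` in the applications; the `r` small terms get the exact constant `Φ_π*(1ʳ) = r / S r`. -/
lemma dualLorentzNorm_le (hpos : ∀ j, 0 < w j) (hanti : Antitone w) {ξ : ℕ →₀ ℝ} {M δ : ℝ}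
    {m r : ℕ} (hM : 0 ≤ M) (hδ : 0 ≤ δ) (hr : 0 < r)
    (h : ∀ j, decreasingRearrangement ξ j ≤ (if j < m then M else 0) + (if j < r then δ else 0)) :
    dualLorentzNorm w ξ ≤ M * (m / w 0) + δ * (r / ∑ j ∈ Finset.range r, w j) := by
  have key : ∀ (n q : ℕ) (c : ℝ),
      ∑ j ∈ Finset.range n, (if j < q then c else 0) = c * (min n q : ℕ) := by
    intro n q c
    rw [← Finset.sum_filter]
    have : (Finset.range n).filter (· < q) = Finset.range (min n q) := by
      ext j; simp
    rw [this]
    simp [mul_comm]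
  refine ciSup_le fun n => ?_
  set S := ∑ j ∈ Finset.range (n + 1), w j
  have hS : 0 < S := sum_range_pos hpos (Nat.succ_pos n)
  have hS0 : w 0 ≤ S := by
    simpa using sum_range_mono hpos (n := 1) (r := n + 1) (by omega)
  set Sr := ∑ j ∈ Finset.range r, w j
  have hSr : 0 < Sr := sum_range_pos hpos hr
  have h1 : ∑ j ∈ Finset.range (n + 1), decreasingRearrangement ξ j
      ≤ M * (min (n + 1) m : ℕ) + δ * (min (n + 1) r : ℕ) := by
    refine (Finset.sum_le_sum fun j _ => h j).trans_eq ?_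
    rw [Finset.sum_add_distrib, key, key]
  have h2 : ((min (n + 1) m : ℕ) : ℝ) / S ≤ m / w 0 := by
    have : ((min (n + 1) m : ℕ) : ℝ) ≤ m := by exact_mod_cast min_le_right _ _
    exact div_le_div₀ (Nat.cast_nonneg m) this (hpos 0) hS0
  have h3 : ((min (n + 1) r : ℕ) : ℝ) / S ≤ r / Sr := by
    rcases le_total (n + 1) r with hnr | hnr
    · rw [min_eq_left hnr, div_le_div_iff₀ hS hSr]
      exact mul_sum_range_le hanti hnr
    · rw [min_eq_right hnr]
      exact div_le_div_of_nonneg_left (Nat.cast_nonneg r) hSr (sum_range_mono hpos hnr)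
  calc _ ≤ (M * (min (n + 1) m : ℕ) + δ * (min (n + 1) r : ℕ)) / S :=
        div_le_div_of_nonneg_right h1 hS.le
    _ = M * ((min (n + 1) m : ℕ) / S) + δ * ((min (n + 1) r : ℕ) / S) := by ring
    _ ≤ _ := add_le_add (mul_le_mul_of_nonneg_left h2 hM) (mul_le_mul_of_nonneg_left h3 hδ)

lemma tendsto_sum_range_atTop (hpos : ∀ j, 0 < w j) (hsum : ¬ Summable w) :
    Filter.Tendsto (fun n => ∑ j ∈ Finset.range n, w j) Filter.atTop Filter.atTop :=
  (not_summable_iff_tendsto_nat_atTop_of_nonneg fun j => (hpos j).le).1 hsum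

lemma tendsto_div_sum_range_atTop (hpos : ∀ j, 0 < w j)
    (hlim : Filter.Tendsto w Filter.atTop (nhds 0)) :
    Filter.Tendsto (fun n : ℕ => (n : ℝ) / ∑ j ∈ Finset.range n, w j)
      Filter.atTop Filter.atTop := by
  have h1 := hlim.cesaro
  have h2 : Filter.Tendsto (fun n : ℕ => (n : ℝ)⁻¹ * ∑ j ∈ Finset.range n, w j) Filter.atTop
      (nhdsWithin 0 (Set.Ioi 0)) := by
    refine tendsto_nhdsWithin_iff.2 ⟨h1, ?_⟩
    filter_upwards [Filter.eventually_gt_atTop 0] with n hn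
    exact mul_pos (inv_pos.2 (by exact_mod_cast hn)) (sum_range_pos hpos hn)
  refine h2.inv_tendsto_nhdsGT_zero.congr fun n => ?_
  simp [div_eq_mul_inv, mul_comm]

end Rearrangement

/-! ### Singular numbers -/

section Singular

variable {H : Type u} [NormedAddCommGroup H] [InnerProductSpace ℂ H] [CompleteSpace H]

/-- The operators `|T|` and `T` have the same norms on vectors. -/
lemma norm_sqrt_star_mul_self_apply (T : H →L[ℂ] H) (x : H) :
    ‖(CFC.sqrt (star T * T) : H →L[ℂ] H) x‖ = ‖T x‖ := by
  set R : H →L[ℂ] H := CFC.sqrt (star T * T)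
  have hR : star R = R := (IsSelfAdjoint.of_nonneg (CFC.sqrt_nonneg _)).star_eq
  have hRR : star R * R = star T * T := by
    rw [hR]; exact CFC.sqrt_mul_sqrt_self _ (star_mul_self_nonneg T)
  have key : ∀ A : H →L[ℂ] H, ((‖A x‖ ^ 2 : ℝ) : ℂ) = ⟪x, (star A * A) x⟫_ℂ := by
    intro A
    rw [ContinuousLinearMap.star_eq_adjoint, mul_apply_eq_comp,
      ContinuousLinearMap.adjoint_inner_right, inner_self_eq_norm_sq_to_K]
    simp
  have h : ‖R x‖ ^ 2 = ‖T x‖ ^ 2 := by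
    have := (key R).trans ((congrArg (fun A : H →L[ℂ] H => ⟪x, A x⟫_ℂ) hRR).trans (key T).symm)
    exact_mod_cast this
  exact (sq_eq_sq₀ (norm_nonneg _) (norm_nonneg _)).1 h

/-- On the sum of the eigenspaces of `|T|` for eigenvalues above `δ` the operator `T` expands by
more than `δ`; hence `T - Y`, being bounded by `δ`, cannot agree with `T` at a nonzero vector
there, and `Y` is injective on that sum. -/
lemma sum_finrank_eigenspace_le {T X Y : H →L[ℂ] H} (hT : T = X + Y) {δ : ℝ} (hX : ‖X‖ ≤ δ)
    {m : ℕ} (hY : (Y : H →ₗ[ℂ] H).rank ≤ m) (F : Finset {t : ℝ // 0 < t})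
    (hF : ∀ t ∈ F, δ < (t : ℝ)) :
    ∑ t ∈ F, Module.finrank ℂ (Module.End.eigenspace
        ((CFC.sqrt (star T * T) : H →L[ℂ] H) : Module.End ℂ H) ((t : ℝ) : ℂ)) ≤ m := by
  classical
  have hδ : 0 ≤ δ := (norm_nonneg X).trans hX
  set R : H →L[ℂ] H := CFC.sqrt (star T * T) with hRdef
  have hRsa : IsSelfAdjoint R := IsSelfAdjoint.of_nonneg (CFC.sqrt_nonneg _)
  have hsymm : (R : H →ₗ[ℂ] H).IsSymmetric :=
    ContinuousLinearMap.isSelfAdjoint_iff_isSymmetric.1 hRsa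
  let E : F → Submodule ℂ H := fun t =>
    Module.End.eigenspace (R : Module.End ℂ H) (((t : {t : ℝ // 0 < t}) : ℝ) : ℂ)
  have hE : OrthogonalFamily ℂ (fun t => E t) fun t => (E t).subtypeₗᵢ := by
    refine hsymm.orthogonalFamily_eigenspaces.comp
      (γ := F) (f := fun t => (((t : {t : ℝ // 0 < t}) : ℝ) : ℂ)) ?_
    intro s t hst
    exact Subtype.ext (Subtype.ext (Complex.ofReal_injective hst))
  let Ψ : (∀ t, E t) →ₗ[ℂ] H := LinearMap.lsum ℂ (fun t => E t) ℂ (fun t => (E t).subtype)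
  have hΨ : ∀ v, Ψ v = ∑ t, (v t : H) := fun v => by simp [Ψ]
  have hnorm : ∀ v, ‖Ψ v‖ ^ 2 = ∑ t, ‖(v t : H)‖ ^ 2 := by
    intro v
    rw [hΨ]
    simpa using hE.norm_sum v Finset.univ
  have hRnorm : ∀ v, ‖T (Ψ v)‖ ^ 2
      = ∑ t : F, ((t : {t : ℝ // 0 < t}) : ℝ) ^ 2 * ‖(v t : H)‖ ^ 2 := by
    intro v
    rw [← norm_sqrt_star_mul_self_apply, ← hRdef, hΨ, map_sum]
    have h1 : ∀ t : F, R (v t : H)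
        = (((((t : {t : ℝ // 0 < t}) : ℝ) : ℂ) • v t : E t) : H) := by
      intro t
      exact Module.End.mem_eigenspace_iff.1 (v t).2
    simp only [h1]
    have := hE.norm_sum (fun t : F => ((((t : {t : ℝ // 0 < t}) : ℝ) : ℂ) • v t : E t)) Finset.univ
    simp only [Submodule.coe_subtypeₗᵢ, Submodule.subtype_apply] at this
    rw [this]
    refine Finset.sum_congr rfl fun t _ => ?_
    rw [Submodule.coe_norm, Submodule.coe_smul, norm_smul, mul_pow, Complex.norm_real,
      Real.norm_eq_abs, sq_abs]
  have hinj : Function.Injective ((Y : H →ₗ[ℂ] H) ∘ₗ Ψ) := by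
    rw [injective_iff_map_eq_zero]
    intro v hv
    have hv' : Y (Ψ v) = 0 := hv
    have h1 : ‖T (Ψ v)‖ ≤ δ * ‖Ψ v‖ := by
      rw [hT, add_apply, hv', add_zero]
      exact (X.le_opNorm _).trans (mul_le_mul_of_nonneg_right hX (norm_nonneg _))
    have h2 : ‖T (Ψ v)‖ ^ 2 ≤ δ ^ 2 * ‖Ψ v‖ ^ 2 := by
      rw [← mul_pow]; exact pow_le_pow_left₀ (norm_nonneg _) h1 2
    rw [hRnorm, hnorm, Finset.mul_sum] at h2
    funext t
    by_contra hvt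
    have hlt : δ ^ 2 < ((t : {t : ℝ // 0 < t}) : ℝ) ^ 2 :=
      pow_lt_pow_left₀ (hF t t.2) hδ two_ne_zero
    refine absurd h2 (not_le.2 (Finset.sum_lt_sum (fun s _ => ?_) ⟨t, Finset.mem_univ _, ?_⟩))
    · exact mul_le_mul_of_nonneg_right (pow_le_pow_left₀ hδ (hF s s.2).le 2) (sq_nonneg _)
    · refine mul_lt_mul_of_pos_right hlt (pow_pos (norm_pos_iff.2 ?_) 2)
      exact fun h => hvt (Subtype.ext h)
  have hrank : Module.rank ℂ (∀ t, E t) ≤ m := by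
    have h1 := LinearMap.rank_comp_le_left Ψ (Y : H →ₗ[ℂ] H)
    have h2 : Module.rank ℂ (∀ t, E t) = LinearMap.rank ((Y : H →ₗ[ℂ] H) ∘ₗ Ψ) :=
      (rank_range_of_injective _ hinj).symm
    exact h2.trans_le (h1.trans hY)
  have hfin : Module.Finite ℂ (∀ t, E t) :=
    Module.rank_lt_aleph0_iff.1 (hrank.trans_lt (Cardinal.natCast_lt_aleph0))
  have hfin' : ∀ t, Module.Finite ℂ (E t) := fun t =>
    Module.Finite.of_surjective (LinearMap.proj t : (∀ t, E t) →ₗ[ℂ] E t)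
      (LinearMap.proj_surjective t)
  have hfr : Module.finrank ℂ (∀ t, E t) ≤ m := Module.finrank_le_of_rank_le hrank
  rw [Module.finrank_pi_fintype] at hfr
  rwa [← Finset.sum_coe_sort]

lemma singularMultiset_pos (T : H →L[ℂ] H) {x : ℝ} (hx : x ∈ singularMultiset T) : 0 < x := by
  classical
  unfold singularMultiset at hx
  rw [finsum_def] at hx
  split_ifs at hx
  · obtain ⟨t, -, ht⟩ := Multiset.mem_sum.1 hx
    rw [Multiset.eq_of_mem_replicate ht]
    exact t.2
  · exact absurd hx (Multiset.notMem_zero x)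

/-- A perturbation of rank `m` of an operator of norm `δ` has at most `m` singular numbers
above `δ`. -/
lemma card_filter_singularMultiset_le {T X Y : H →L[ℂ] H} (hT : T = X + Y) {δ : ℝ} (hX : ‖X‖ ≤ δ)
    {m : ℕ} (hY : (Y : H →ₗ[ℂ] H).rank ≤ m) :
    ((singularMultiset T).filter (δ < ·)).card ≤ m := by
  classical
  unfold singularMultiset
  rw [finsum_def]
  split_ifs with hfin
  · have h : ∀ F : Finset {t : ℝ // 0 < t}, ((∑ t ∈ F, Multiset.replicate
        (Module.finrank ℂ (Module.End.eigenspace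
        ((CFC.sqrt (star T * T) : H →L[ℂ] H) : Module.End ℂ H) ((t : ℝ) : ℂ))) (t : ℝ)).filter
        (δ < ·)).card = ∑ t ∈ F.filter (fun t : {t : ℝ // 0 < t} => δ < (t : ℝ)),
        Module.finrank ℂ (Module.End.eigenspace
          ((CFC.sqrt (star T * T) : H →L[ℂ] H) : Module.End ℂ H) ((t : ℝ) : ℂ)) := by
      intro F
      induction F using Finset.induction_on with
      | empty => simp
      | insert a s ha ih =>
        rw [Finset.sum_insert ha, Multiset.filter_add, Multiset.card_add, ih, Finset.filter_insert]
        by_cases hδa : δ < (a : ℝ)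
        · rw [if_pos hδa, Finset.sum_insert (by simp [ha]), Multiset.filter_eq_self.2,
            Multiset.card_replicate]
          intro x hx
          rwa [Multiset.eq_of_mem_replicate hx]
        · rw [if_neg hδa, Multiset.filter_eq_nil.2, Multiset.card_zero, zero_add]
          intro x hx
          rwa [Multiset.eq_of_mem_replicate hx]
    rw [h]
    exact sum_finrank_eigenspace_le hT hX hY _ fun t ht => (Finset.mem_filter.1 ht).2
  -- For infinitely many eigenvalues `finsum` takes the value `0`, and the bound is trivial.
  · simp

lemma decreasingRearrangement_singularNumbers_le {T X Y : H →L[ℂ] H} (hT : T = X + Y) {δ : ℝ}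
    (hX : ‖X‖ ≤ δ) {m : ℕ} (hY : (Y : H →ₗ[ℂ] H).rank ≤ m) {j : ℕ} (hj : m ≤ j) :
    decreasingRearrangement (singularNumbers T) j ≤ δ :=
  decreasingRearrangement_decreasingList_le (fun _ hx => (singularMultiset_pos T hx).le)
    ((norm_nonneg X).trans hX) (card_filter_singularMultiset_le hT hX hY) hj

/-- The singular numbers of the sum of an operator of norm `δ` and rank `p` and an operator of
norm `M` and rank `m`. -/
lemma decreasingRearrangement_singularNumbers_add_le {X Y : H →L[ℂ] H} {δ M : ℝ} {p m : ℕ}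
    (hX : ‖X‖ ≤ δ) (hXr : (X : H →ₗ[ℂ] H).rank ≤ p) (hY : ‖Y‖ ≤ M)
    (hYr : (Y : H →ₗ[ℂ] H).rank ≤ m) (j : ℕ) :
    decreasingRearrangement (singularNumbers (X + Y)) j
      ≤ (if j < m then M else 0) + (if j < p + m then δ else 0) := by
  by_cases h1 : j < m
  · rw [if_pos h1, if_pos (by omega)]
    refine decreasingRearrangement_singularNumbers_le (X := X + Y) (Y := 0) (m := 0)
      (add_zero _).symm ?_ ?_ (Nat.zero_le j)
    · rw [add_comm M]
      exact (norm_add_le X Y).trans (add_le_add hX hY)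
    · simp
  · rw [if_neg h1, zero_add]
    split_ifs with h2
    · exact decreasingRearrangement_singularNumbers_le rfl hX hYr (by omega)
    · refine decreasingRearrangement_singularNumbers_le (X := 0) (Y := X + Y) (m := p + m)
        (zero_add _).symm (by simp) ?_ (by omega)
      push_cast
      exact (LinearMap.rank_add_le _ _).trans (add_le_add hXr hYr)

variable {w : ℕ → ℝ}

lemma hybridNorm_lorentzPair_le (hpos : ∀ j, 0 < w j) (hanti : Antitone w)
    {X Y : Fin 2 → H →L[ℂ] H} {δ : Fin 2 → ℝ} {M c : ℝ} {p m : ℕ} (hp : 0 < p)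
    (hX : ∀ j, ‖X j‖ ≤ δ j) (hXr : ∀ j, (X j : H →ₗ[ℂ] H).rank ≤ p)
    (hY : ∀ j, ‖Y j‖ ≤ M) (hYr : ∀ j, (Y j : H →ₗ[ℂ] H).rank ≤ m)
    (h0 : M * (∑ j ∈ Finset.range m, w j) + δ 0 * ∑ j ∈ Finset.range (p + m), w j ≤ c)
    (h1 : M * (m / w 0) + δ 1 * ((p + m : ℕ) / ∑ j ∈ Finset.range (p + m), w j) ≤ c) :
    hybridNorm (lorentzPair w) (fun j => X j + Y j) ≤ ENNReal.ofReal c := by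
  refine iSup_le fun j => ?_
  refine ENNReal.ofReal_le_ofReal ?_
  have h := decreasingRearrangement_singularNumbers_add_le (hX j) (hXr j) (hY j) (hYr j)
  fin_cases j
  · exact (lorentzNorm_le hpos h).trans h0
  · exact (dualLorentzNorm_le hpos hanti ((norm_nonneg _).trans (hY 0))
      ((norm_nonneg _).trans (hX 1)) (by omega) h).trans h1

end Singular

/-! ### Spectral projections of boxes -/

section Spectral

variable {H : Type u} [NormedAddCommGroup H] [InnerProductSpace ℂ H] [CompleteSpace H]

open Filter MeasureTheory Topology

variable {τ : Fin 2 → H →L[ℂ] H}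

lemma IsCommutingHermitian.isStarNormal (hτ : IsCommutingHermitian τ) :
    IsStarNormal (τ 0 + Complex.I • τ 1) := by
  have h0 : star (τ 0) = τ 0 := hτ.1 0
  have h1 : star (τ 1) = τ 1 := hτ.1 1
  have hc : τ 0 * τ 1 = τ 1 * τ 0 := hτ.2 0 1
  have hs : star (τ 0 + Complex.I • τ 1) = τ 0 - Complex.I • τ 1 := by
    rw [star_add, star_smul, h0, h1]
    simp [sub_eq_add_neg]
  refine ⟨?_⟩
  rw [hs]
  change (_ - _) * (_ + _) = (_ + _) * (_ - _)
  simp only [mul_add, add_mul, sub_mul, mul_sub, smul_mul_assoc, mul_smul_comm, hc, smul_sub,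
    smul_add, smul_smul]
  abel

lemma pairCFC_mul {f g : (Fin 2 → ℝ) → ℝ} (hf : Continuous f) (hg : Continuous g) :
    pairCFC τ (fun x => f x * g x) = pairCFC τ f * pairCFC τ g := by
  unfold pairCFC
  rw [← cfc_mul _ _ _ (continuous_pairCoord hf).continuousOn (continuous_pairCoord hg).continuousOn]
  simp

lemma pairCFC_sub {f g : (Fin 2 → ℝ) → ℝ} (hf : Continuous f) (hg : Continuous g) :
    pairCFC τ (fun x => f x - g x) = pairCFC τ f - pairCFC τ g := by
  unfold pairCFC
  rw [← cfc_sub _ _ _ (continuous_pairCoord hf).continuousOn (continuous_pairCoord hg).continuousOn]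
  simp

lemma pairCFC_const (hτ : IsCommutingHermitian τ) (c : ℝ) :
    pairCFC τ (fun _ => c) = (c : ℂ) • 1 := by
  have := hτ.isStarNormal
  unfold pairCFC
  rw [cfc_const (c : ℂ) (τ 0 + Complex.I • τ 1), Algebra.algebraMap_eq_smul_one]

lemma isSelfAdjoint_pairCFC (f : (Fin 2 → ℝ) → ℝ) : IsSelfAdjoint (pairCFC τ f) := by
  unfold pairCFC IsSelfAdjoint
  rw [← cfc_star]
  simp

lemma inner_apply_left_of_isSelfAdjoint {A : H →L[ℂ] H} (hA : IsSelfAdjoint A) (x y : H) :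
    ⟪A x, y⟫_ℂ = ⟪x, A y⟫_ℂ :=
  (ContinuousLinearMap.isSelfAdjoint_iff_isSymmetric.1 hA) x y

/-- `‖f(τ) ξ‖² = ∫ f² dμ_ξ`. -/
lemma norm_pairCFC_apply_sq (f : C_c(Fin 2 → ℝ, ℝ)) (ξ : H) :
    ‖pairCFC τ f ξ‖ ^ 2 = ∫ x, f x ^ 2 ∂(scalarSpectralMeasure τ ξ) := by
  have h := integral_scalarSpectralMeasure τ ξ (f * f)
  have h2 : pairCFC τ (f * f : C_c(Fin 2 → ℝ, ℝ)) = pairCFC τ f * pairCFC τ f :=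
    pairCFC_mul f.continuous f.continuous
  rw [h2, mul_apply_eq_comp, ← inner_apply_left_of_isSelfAdjoint (isSelfAdjoint_pairCFC _)] at h
  rw [← inner_self_eq_norm_sq (𝕜 := ℂ)]
  refine Eq.trans h.symm (integral_congr_ae (Eventually.of_forall fun x => ?_))
  simp [sq]

/-- Multiplication of a compactly supported function by a continuous function. -/
def mulCc {h : (Fin 2 → ℝ) → ℝ} (hh : Continuous h) (f : C_c(Fin 2 → ℝ, ℝ)) :
    C_c(Fin 2 → ℝ, ℝ) where
  toFun := fun x => h x * f x
  continuous_toFun := hh.mul f.continuous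
  hasCompactSupport' := f.hasCompactSupport.mul_left

lemma pairCFC_mulCc {h : (Fin 2 → ℝ) → ℝ} (hh : Continuous h) (f : C_c(Fin 2 → ℝ, ℝ)) :
    pairCFC τ (mulCc hh f) = pairCFC τ h * pairCFC τ f :=
  pairCFC_mul hh f.continuous

lemma commute_pairCFC (hτ : IsCommutingHermitian τ) {f : (Fin 2 → ℝ) → ℝ} (hf : Continuous f)
    (j : Fin 2) : Commute (τ j) (pairCFC τ f) := by
  have h := pairCFC_mul (τ := τ) hf (continuous_apply j)
  have h' := pairCFC_mul (τ := τ) (continuous_apply j) hf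
  rw [pairCFC_coord hτ] at h h'
  change _ = _
  rw [← h, ← h']
  congr 1
  funext x
  exact mul_comm _ _

/-- A compactly supported cutoff function of a compact set inside an open set. -/
lemma exists_cutoff {K U : Set (Fin 2 → ℝ)} (hK : IsCompact K) (hU : IsOpen U) (hKU : K ⊆ U) :
    ∃ f : C_c(Fin 2 → ℝ, ℝ), (∀ x ∈ K, f x = 1) ∧ (∀ x ∉ U, f x = 0) ∧
      ∀ x, f x ∈ Set.Icc (0 : ℝ) 1 := by
  obtain ⟨f, h1, h0, hc, hI⟩ := exists_continuous_one_zero_of_isCompact hK hU.isClosed_compl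
    (Set.disjoint_compl_right_iff_subset.2 hKU)
  exact ⟨⟨f, hc⟩, fun x hx => h1 hx, fun x hx => h0 hx, hI⟩

lemma norm_pairCFC_le {f : (Fin 2 → ℝ) → ℝ} {c : ℝ} (hc : 0 ≤ c) (hf : ∀ x, |f x| ≤ c) :
    ‖pairCFC τ f‖ ≤ c := by
  unfold pairCFC
  refine norm_cfc_le hc fun z _ => ?_
  rw [Complex.norm_real]
  exact hf _

lemma re_inner_pairCFC_le {f : (Fin 2 → ℝ) → ℝ} (hf : ∀ x, f x ∈ Set.Icc (0 : ℝ) 1) (ξ : H) :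
    (⟪ξ, pairCFC τ f ξ⟫_ℂ).re ≤ ‖ξ‖ ^ 2 := by
  have h1 : ‖pairCFC τ f‖ ≤ 1 :=
    norm_pairCFC_le zero_le_one fun x => abs_le.2 ⟨by linarith [(hf x).1], (hf x).2⟩
  calc (⟪ξ, pairCFC τ f ξ⟫_ℂ).re ≤ ‖ξ‖ * ‖pairCFC τ f ξ‖ := re_inner_le_norm (𝕜 := ℂ) _ _
    _ ≤ ‖ξ‖ * (1 * ‖ξ‖) := by
        gcongr
        exact (ContinuousLinearMap.le_opNorm _ _).trans (by gcongr)
    _ = ‖ξ‖ ^ 2 := by ring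

instance regular_scalarSpectralMeasure (τ : Fin 2 → H →L[ℂ] H) (ξ : H) :
    (scalarSpectralMeasure τ ξ).Regular := RealRMK.regular_rieszMeasure _

instance isFiniteMeasure_scalarSpectralMeasure (τ : Fin 2 → H →L[ℂ] H) (ξ : H) :
    IsFiniteMeasure (scalarSpectralMeasure τ ξ) := by
  refine ⟨?_⟩
  have hball : ∀ n : ℕ, scalarSpectralMeasure τ ξ (Metric.closedBall 0 n)
      ≤ ENNReal.ofReal (‖ξ‖ ^ 2) := by
    intro n
    obtain ⟨f, h1, -, hI⟩ := exists_cutoff (isCompact_closedBall (0 : Fin 2 → ℝ) n) isOpen_univ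
      (Set.subset_univ _)
    refine (RealRMK.rieszMeasure_le_of_eq_one (spectralFunctional τ ξ) (fun x => (hI x).1)
      (isCompact_closedBall (0 : Fin 2 → ℝ) n) h1).trans (ENNReal.ofReal_le_ofReal ?_)
    exact re_inner_pairCFC_le hI ξ
  have hmono : Monotone fun n : ℕ => Metric.closedBall (0 : Fin 2 → ℝ) n := fun m n hmn =>
    Metric.closedBall_subset_closedBall (by exact_mod_cast hmn)
  have hU : ⋃ n : ℕ, Metric.closedBall (0 : Fin 2 → ℝ) n = Set.univ :=
    Metric.iUnion_closedBall_nat 0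
  rw [← hU, hmono.measure_iUnion]
  exact (iSup_le hball).trans_lt ENNReal.ofReal_lt_top

/-- The joint spectrum lies in the closed ball of radius `‖τ‖`. -/
lemma norm_sq_le_measureReal_ball [Nontrivial H] (hτ : IsCommutingHermitian τ) {R : ℝ}
    (hR : ‖τ‖ < R) (ξ : H) :
    ‖ξ‖ ^ 2 ≤ (scalarSpectralMeasure τ ξ).real (Metric.ball 0 R) := by
  have hN := hτ.isStarNormal
  obtain ⟨f, h1, h0, hI⟩ := exists_cutoff (isCompact_closedBall (0 : Fin 2 → ℝ) ‖τ‖)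
    (Metric.isOpen_ball (x := 0) (ε := R)) (Metric.closedBall_subset_ball hR)
  have hf : pairCFC τ f = 1 := by
    rw [← cfc_one ℂ (τ 0 + Complex.I • τ 1)]
    refine cfc_congr fun z hz => ?_
    have hcoord : ∀ j : Fin 2, |(![z.re, z.im] : Fin 2 → ℝ) j| ≤ ‖τ‖ := by
      intro j
      have hmem : (((![z.re, z.im] : Fin 2 → ℝ) j : ℝ) : ℂ) ∈ spectrum ℂ (τ j) := by
        rw [← pairCFC_coord hτ j]
        unfold pairCFC
        rw [cfc_map_spectrum (R := ℂ) _ _ hN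
          (continuous_pairCoord (continuous_apply j)).continuousOn]
        exact ⟨z, hz, rfl⟩
      have := (spectrum.norm_le_norm_of_mem hmem).trans (norm_le_pi_norm τ j)
      rwa [Complex.norm_real] at this
    have : f ![z.re, z.im] = 1 := by
      refine h1 _ ?_
      rw [mem_closedBall_zero_iff, pi_norm_le_iff_of_nonneg (norm_nonneg _)]
      exact hcoord
    simp [this]
  have h2 := integral_scalarSpectralMeasure τ ξ f
  rw [hf, one_apply_eq_self] at h2
  have h3 : ∫ x, f x ∂(scalarSpectralMeasure τ ξ) = ‖ξ‖ ^ 2 := by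
    rw [h2]; exact inner_self_eq_norm_sq (𝕜 := ℂ) ξ
  rw [← h3, ← integral_indicator_one Metric.isOpen_ball.measurableSet]
  refine integral_mono (f.continuous.integrable_of_hasCompactSupport f.hasCompactSupport)
    ((integrable_const (1 : ℝ)).indicator Metric.isOpen_ball.measurableSet) fun x => ?_
  by_cases hx : x ∈ Metric.ball (0 : Fin 2 → ℝ) R
  · simpa [Set.indicator_of_mem hx] using (hI x).2
  · simpa [Set.indicator_of_notMem hx] using (h0 x hx).le

/-- The operator `E` is the value `E(B)` of the spectral measure of `τ` at a bounded set `B` whose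
indicator function is the pointwise limit of a sequence of continuous functions with values in
`[0, 1]` and supports in a common compact set: the strong limit of the functional calculus. -/
def IsSpectralProjection (τ : Fin 2 → H →L[ℂ] H) (B : Set (Fin 2 → ℝ)) (E : H →L[ℂ] H) : Prop :=
  ∃ (g : ℕ → C_c(Fin 2 → ℝ, ℝ)) (K : Set (Fin 2 → ℝ)), IsCompact K ∧ (∀ n, ∀ x ∉ K, g n x = 0) ∧
    (∀ n x, g n x ∈ Set.Icc (0 : ℝ) 1) ∧
    (∀ x, Tendsto (fun n => g n x) atTop (𝓝 (B.indicator 1 x))) ∧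
    ∀ ξ : H, Tendsto (fun n => pairCFC τ (g n) ξ) atTop (𝓝 (E ξ))

/-- By dominated convergence for the scalar spectral measures, the functional calculus of a
bounded pointwise convergent sequence converges strongly. -/
lemma exists_isSpectralProjection (τ : Fin 2 → H →L[ℂ] H) {B : Set (Fin 2 → ℝ)}
    {g : ℕ → C_c(Fin 2 → ℝ, ℝ)} {K : Set (Fin 2 → ℝ)} (hK : IsCompact K)
    (hgK : ∀ n, ∀ x ∉ K, g n x = 0) (hI : ∀ n x, g n x ∈ Set.Icc (0 : ℝ) 1)
    (hg : ∀ x, Tendsto (fun n => g n x) atTop (𝓝 (B.indicator 1 x))) :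
    ∃ E, IsSpectralProjection τ B E := by
  have hconv : ∀ ξ : H, ∃ η, Tendsto (fun n => pairCFC τ (g n) ξ) atTop (𝓝 η) := by
    intro ξ
    refine cauchySeq_tendsto_of_complete (cauchySeq_iff_tendsto_dist_atTop_0.2 ?_)
    have h1 : ∀ p : ℕ × ℕ, dist (pairCFC τ (g p.1) ξ) (pairCFC τ (g p.2) ξ) ^ 2
        = ∫ x, (g p.1 x - g p.2 x) ^ 2 ∂(scalarSpectralMeasure τ ξ) := by
      intro p
      have h := norm_pairCFC_apply_sq (τ := τ) (g p.1 - g p.2) ξ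
      have h2 : pairCFC τ (g p.1 - g p.2 : C_c(Fin 2 → ℝ, ℝ))
          = pairCFC τ (g p.1) - pairCFC τ (g p.2) :=
        pairCFC_sub (g p.1).continuous (g p.2).continuous
      rw [h2, sub_apply] at h
      rw [dist_eq_norm, h]
      rfl
    have h2 : Tendsto (fun p : ℕ × ℕ =>
        ∫ x, (g p.1 x - g p.2 x) ^ 2 ∂(scalarSpectralMeasure τ ξ)) atTop (𝓝 0) := by
      have := tendsto_integral_filter_of_dominated_convergence (l := (atTop : Filter (ℕ × ℕ)))
        (μ := scalarSpectralMeasure τ ξ)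
        (F := fun p x => (g p.1 x - g p.2 x) ^ 2) (f := fun _ => (0 : ℝ)) (fun _ => 1) ?_ ?_
        (integrable_const _) ?_
      · simpa using this
      · refine Eventually.of_forall fun p => Continuous.aestronglyMeasurable ?_
        exact ((g p.1).continuous.sub (g p.2).continuous).pow 2
      · refine Eventually.of_forall fun p => Eventually.of_forall fun x => ?_
        have a := hI p.1 x
        have b := hI p.2 x
        rw [Real.norm_eq_abs, abs_of_nonneg (sq_nonneg _), sq_le_one_iff_abs_le_one, abs_le]
        constructor <;> linarith [a.1, a.2, b.1, b.2]
      · refine Eventually.of_forall fun x => ?_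
        rw [← prod_atTop_atTop_eq]
        have := (((hg x).comp tendsto_fst).sub ((hg x).comp tendsto_snd)).pow 2
        simpa using this
    have h3 := (Real.continuous_sqrt.tendsto 0).comp h2
    rw [Real.sqrt_zero] at h3
    refine h3.congr fun p => ?_
    rw [Function.comp_apply, ← h1, Real.sqrt_sq dist_nonneg]
  choose η hη using hconv
  exact ⟨continuousLinearMapOfTendsto (fun n => pairCFC τ (g n)) (tendsto_pi_nhds.2 hη),
    g, K, hK, hgK, hI, hg, hη⟩

namespace IsSpectralProjection

variable {B B' : Set (Fin 2 → ℝ)} {E E' : H →L[ℂ] H}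

lemma isSelfAdjoint (hE : IsSpectralProjection τ B E) : IsSelfAdjoint E := by
  obtain ⟨g, -, -, -, -, -, hlim⟩ := hE
  rw [ContinuousLinearMap.isSelfAdjoint_iff_isSymmetric]
  intro x y
  refine tendsto_nhds_unique ((hlim x).inner tendsto_const_nhds)
    ((tendsto_const_nhds.inner (hlim y)).congr fun n => ?_)
  exact (inner_apply_left_of_isSelfAdjoint (isSelfAdjoint_pairCFC _) x y).symm

lemma commute (hτ : IsCommutingHermitian τ) (hE : IsSpectralProjection τ B E) (j : Fin 2) :
    Commute (τ j) E := by
  obtain ⟨g, -, -, -, -, -, hlim⟩ := hE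
  ext x
  refine tendsto_nhds_unique (((τ j).continuous.tendsto _).comp (hlim x))
    ((hlim (τ j x)).congr fun n => ?_)
  exact (DFunLike.congr_fun (commute_pairCFC hτ (g n).continuous j) x).symm

/-- `‖h(τ) E(B) ξ‖² = ∫_B h² dμ_ξ` for continuous `h`. -/
lemma norm_pairCFC_apply_sq (hB : MeasurableSet B) (hE : IsSpectralProjection τ B E)
    {h : (Fin 2 → ℝ) → ℝ} (hh : Continuous h) (ξ : H) :
    ‖pairCFC τ h (E ξ)‖ ^ 2 = ∫ x in B, h x ^ 2 ∂(scalarSpectralMeasure τ ξ) := by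
  obtain ⟨g, K, hK, hgK, hI, hg, hlim⟩ := hE
  obtain ⟨c, hc⟩ := hK.exists_bound_of_continuousOn hh.continuousOn
  have h1 : Tendsto (fun n => ‖pairCFC τ h (pairCFC τ (g n) ξ)‖ ^ 2) atTop
      (𝓝 (‖pairCFC τ h (E ξ)‖ ^ 2)) :=
    ((((pairCFC τ h).continuous.tendsto _).comp (hlim ξ)).norm).pow 2
  refine tendsto_nhds_unique h1 ?_
  rw [← integral_indicator hB]
  have h2 : ∀ n, ‖pairCFC τ h (pairCFC τ (g n) ξ)‖ ^ 2
      = ∫ x, (h x * g n x) ^ 2 ∂(scalarSpectralMeasure τ ξ) := by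
    intro n
    rw [← mul_apply_eq_comp, ← pairCFC_mulCc hh, HybridPerturbation.norm_pairCFC_apply_sq]
    rfl
  simp only [h2]
  refine tendsto_integral_of_dominated_convergence (fun _ => c ^ 2) ?_ (integrable_const _) ?_ ?_
  · exact fun n => ((hh.mul (g n).continuous).pow 2).aestronglyMeasurable
  · refine fun n => Eventually.of_forall fun x => ?_
    by_cases hx : x ∈ K
    · have a := hI n x
      have b := hc x hx
      rw [Real.norm_eq_abs, abs_pow, abs_mul, abs_of_nonneg a.1]
      refine pow_le_pow_left₀ (mul_nonneg (abs_nonneg _) a.1) ?_ 2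
      exact (mul_le_of_le_one_right (abs_nonneg _) a.2).trans b
    · rw [hgK n x hx]
      simpa using sq_nonneg c
  · refine Eventually.of_forall fun x => ?_
    have := ((hg x).const_mul (h x)).pow 2
    refine (this.congr fun n => rfl).trans (le_of_eq ?_)
    by_cases hx : x ∈ B <;> simp [hx]

lemma norm_apply_sq (hτ : IsCommutingHermitian τ) (hB : MeasurableSet B)
    (hE : IsSpectralProjection τ B E) (ξ : H) :
    ‖E ξ‖ ^ 2 = (scalarSpectralMeasure τ ξ).real B := by
  have h := hE.norm_pairCFC_apply_sq hB (continuous_const (y := (1 : ℝ))) ξ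
  rw [pairCFC_const hτ] at h
  simpa using h

lemma inner_apply_self (hB : MeasurableSet B) (hE : IsSpectralProjection τ B E) (ξ : H) :
    (⟪ξ, E ξ⟫_ℂ).re = (scalarSpectralMeasure τ ξ).real B := by
  obtain ⟨g, -, -, -, hI, hg, hlim⟩ := hE
  have h1 : Tendsto (fun n => (⟪ξ, pairCFC τ (g n) ξ⟫_ℂ).re) atTop (𝓝 (⟪ξ, E ξ⟫_ℂ).re) :=
    (Complex.continuous_re.tendsto _).comp (tendsto_const_nhds.inner (hlim ξ))
  refine tendsto_nhds_unique h1 ?_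
  simp only [← integral_scalarSpectralMeasure]
  rw [← integral_indicator_one hB]
  refine tendsto_integral_of_dominated_convergence (fun _ => 1) ?_ (integrable_const _) ?_ ?_
  · exact fun n => (g n).continuous.aestronglyMeasurable
  · refine fun n => Eventually.of_forall fun x => ?_
    rw [Real.norm_eq_abs, abs_of_nonneg (hI n x).1]
    exact (hI n x).2
  · exact Eventually.of_forall fun x => hg x

/-- On the range of `E(B)` the operator `τ j` is as close to the constant `a` as the coordinate
`x j` is on `B`. -/
lemma norm_sub_smul_apply_le (hτ : IsCommutingHermitian τ) (hB : MeasurableSet B)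
    (hE : IsSpectralProjection τ B E) {j : Fin 2} {a δ : ℝ} (hδ : 0 ≤ δ)
    (hBδ : ∀ x ∈ B, |x j - a| ≤ δ) (ξ : H) :
    ‖(τ j - (a : ℂ) • 1) (E ξ)‖ ≤ δ * ‖E ξ‖ := by
  have hcont : Continuous fun x : Fin 2 → ℝ => x j - a := (continuous_apply j).sub continuous_const
  have h := hE.norm_pairCFC_apply_sq hB hcont ξ
  rw [pairCFC_sub (f := fun x => x j) (g := fun _ => a) (continuous_apply j) continuous_const,
    pairCFC_coord hτ, pairCFC_const hτ] at h
  rw [← sq_le_sq₀ (norm_nonneg _) (by positivity), h, mul_pow, hE.norm_apply_sq hτ hB]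
  have hle := norm_setIntegral_le_of_norm_le_const (μ := scalarSpectralMeasure τ ξ)
    (f := fun x : Fin 2 → ℝ => (x j - a) ^ 2) (C := δ ^ 2) (measure_lt_top _ B) fun x hx => by
      rw [Real.norm_eq_abs, abs_pow]
      exact pow_le_pow_left₀ (abs_nonneg _) (hBδ x hx) 2
  exact (le_abs_self _).trans hle

lemma mul_eq_zero (hB' : MeasurableSet B') (hE : IsSpectralProjection τ B E)
    (hE' : IsSpectralProjection τ B' E') (hBB' : Disjoint B B') : E * E' = 0 := by
  obtain ⟨g, -, -, -, hI, hg, hlim⟩ := hE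
  ext ξ
  have h1 : Tendsto (fun n => ‖pairCFC τ (g n) (E' ξ)‖ ^ 2) atTop (𝓝 (‖E (E' ξ)‖ ^ 2)) :=
    (hlim (E' ξ)).norm.pow 2
  have h2 : Tendsto (fun n => ‖pairCFC τ (g n) (E' ξ)‖ ^ 2) atTop (𝓝 0) := by
    have : Tendsto (fun n => ∫ x in B', g n x ^ 2 ∂(scalarSpectralMeasure τ ξ)) atTop
        (𝓝 (∫ x in B', (0 : ℝ) ∂(scalarSpectralMeasure τ ξ))) := by
      refine tendsto_integral_of_dominated_convergence (fun _ => 1) ?_ (integrable_const _) ?_ ?_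
      · exact fun n => ((g n).continuous.pow 2).aestronglyMeasurable
      · refine fun n => Eventually.of_forall fun x => ?_
        rw [Real.norm_eq_abs, abs_of_nonneg (sq_nonneg _)]
        exact pow_le_one₀ (hI n x).1 (hI n x).2
      · filter_upwards [ae_restrict_mem hB'] with x hx
        have hxB : x ∉ B := fun h => Set.disjoint_left.1 hBB' h hx
        have := (hg x).pow 2
        rwa [Set.indicator_of_notMem hxB, zero_pow two_ne_zero] at this
    rw [integral_zero] at this
    exact this.congr fun n => (hE'.norm_pairCFC_apply_sq hB' (g n).continuous ξ).symm
  have h3 := tendsto_nhds_unique h1 h2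
  simpa using h3

end IsSpectralProjection

/-- A continuous approximation of the indicator function of `[0, ∞)`. -/
def ramp (n : ℕ) (t : ℝ) : ℝ := max 0 (min 1 ((n + 1) * t + 1))

lemma continuous_ramp (n : ℕ) : Continuous (ramp n) := by
  unfold ramp; fun_prop

lemma ramp_mem_Icc (n : ℕ) (t : ℝ) : ramp n t ∈ Set.Icc (0 : ℝ) 1 :=
  ⟨le_max_left _ _, max_le zero_le_one (min_le_left _ _)⟩

lemma ramp_of_nonneg (n : ℕ) {t : ℝ} (ht : 0 ≤ t) : ramp n t = 1 := by
  unfold ramp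
  have : (0 : ℝ) ≤ (n + 1) * t := by positivity
  rw [min_eq_left (by linarith), max_eq_right zero_le_one]

lemma ramp_of_le_neg_one (n : ℕ) {t : ℝ} (ht : t ≤ -1) : ramp n t = 0 := by
  unfold ramp
  have : (n : ℝ) * t ≤ 0 := mul_nonpos_of_nonneg_of_nonpos (Nat.cast_nonneg n) (by linarith)
  refine max_eq_left ((min_le_right _ _).trans ?_)
  linarith

lemma tendsto_ramp (t : ℝ) :
    Tendsto (fun n => ramp n t) atTop (𝓝 ((Set.Ici (0 : ℝ)).indicator 1 t)) := by
  by_cases ht : 0 ≤ t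
  · simp [Set.indicator_of_mem (Set.mem_Ici.2 ht), ramp_of_nonneg _ ht]
  · rw [Set.indicator_of_notMem (by simpa using ht)]
    rw [not_le] at ht
    obtain ⟨N, hN⟩ := exists_nat_ge (-t)⁻¹
    refine tendsto_const_nhds.congr' ?_
    filter_upwards [eventually_ge_atTop N] with n hn
    have h1 : (-t)⁻¹ ≤ n := hN.trans (by exact_mod_cast hn)
    have h2 : 1 ≤ (n : ℝ) * (-t) := by
      rwa [inv_le_iff_one_le_mul₀ (by linarith)] at h1
    symm
    refine max_eq_left ((min_le_right _ _).trans ?_)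
    linarith

/-- The half-open box with lower corner `l` and upper corner `u`. -/
def box (l u : Fin 2 → ℝ) : Set (Fin 2 → ℝ) := Set.univ.pi fun i => Set.Ico (l i) (u i)

lemma measurableSet_box (l u : Fin 2 → ℝ) : MeasurableSet (box l u) :=
  MeasurableSet.univ_pi fun _ => measurableSet_Ico

lemma exists_isSpectralProjection_box (τ : Fin 2 → H →L[ℂ] H) (l u : Fin 2 → ℝ) :
    ∃ E, IsSpectralProjection τ (box l u) E := by
  let F : ℕ → (Fin 2 → ℝ) → ℝ := fun n x => ∏ i, ramp n (x i - l i) * (1 - ramp n (x i - u i))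
  have hF : ∀ n, Continuous (F n) := by
    intro n
    refine continuous_finsetProd _ fun i _ => ?_
    exact ((continuous_ramp n).comp (by fun_prop)).mul
      (continuous_const.sub ((continuous_ramp n).comp (by fun_prop)))
  have hK : IsCompact (Set.Icc (fun i => l i - 1) u) := isCompact_Icc
  have hFK : ∀ n, ∀ x ∉ Set.Icc (fun i => l i - 1) u, F n x = 0 := by
    intro n x hx
    have : ∃ i, x i < l i - 1 ∨ u i < x i := by
      by_contra! h
      exact hx ⟨fun i => (h i).1, fun i => (h i).2⟩
    obtain ⟨i, hi⟩ := this
    refine Finset.prod_eq_zero (Finset.mem_univ i) ?_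
    rcases hi with hi | hi
    · rw [ramp_of_le_neg_one n (by linarith), zero_mul]
    · rw [ramp_of_nonneg n (t := x i - u i) (by linarith), sub_self, mul_zero]
  refine exists_isSpectralProjection τ
    (g := fun n => ⟨⟨F n, hF n⟩, HasCompactSupport.intro hK (hFK n)⟩) hK hFK ?_ ?_
  · intro n x
    have h : ∀ i, 0 ≤ ramp n (x i - l i) * (1 - ramp n (x i - u i)) ∧
        ramp n (x i - l i) * (1 - ramp n (x i - u i)) ≤ 1 := by
      intro i
      have a := ramp_mem_Icc n (x i - l i)
      have b := ramp_mem_Icc n (x i - u i)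
      exact ⟨mul_nonneg a.1 (sub_nonneg.2 b.2),
        mul_le_one₀ a.2 (sub_nonneg.2 b.2) (by linarith [b.1])⟩
    have h0 : 0 ≤ F n x := Finset.prod_nonneg fun i _ => (h i).1
    have h1 : F n x ≤ 1 := Finset.prod_le_one (fun i _ => (h i).1) fun i _ => (h i).2
    exact ⟨h0, h1⟩
  · intro x
    have h : Tendsto (fun n => F n x) atTop (𝓝 (∏ i, ((Set.Ici (0 : ℝ)).indicator 1 (x i - l i)
        * (1 - (Set.Ici (0 : ℝ)).indicator 1 (x i - u i))))) :=
      tendsto_finsetProd _ fun i _ =>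
        (tendsto_ramp _).mul (tendsto_const_nhds.sub (tendsto_ramp _))
    refine h.trans (le_of_eq ?_)
    congr 1
    by_cases hx : x ∈ box l u
    · rw [Set.indicator_of_mem hx]
      refine Finset.prod_eq_one fun i _ => ?_
      have := hx i (Set.mem_univ i)
      simp [Set.indicator, this.1, this.2]
    · rw [Set.indicator_of_notMem hx]
      have : ∃ i, x i < l i ∨ u i ≤ x i := by
        by_contra! h
        exact hx fun i _ => h i
      obtain ⟨i, hi⟩ := this
      refine Finset.prod_eq_zero (Finset.mem_univ i) ?_
      rcases hi with hi | hi
      · simp [Set.indicator, hi]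
      · simp [Set.indicator, hi]

end Spectral

/-! ### Ranks of operators -/

section Contraction

variable {H : Type u} [NormedAddCommGroup H] [InnerProductSpace ℂ H] [CompleteSpace H]
open Filter MeasureTheory Topology
variable {τ : Fin 2 → H →L[ℂ] H}

lemma rank_mul_le_left (A B : H →L[ℂ] H) :
    ((A * B : H →L[ℂ] H) : H →ₗ[ℂ] H).rank ≤ (A : H →ₗ[ℂ] H).rank :=
  LinearMap.rank_comp_le_left (B : H →ₗ[ℂ] H) (A : H →ₗ[ℂ] H)

lemma rank_mul_le_right (A B : H →L[ℂ] H) :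
    ((A * B : H →L[ℂ] H) : H →ₗ[ℂ] H).rank ≤ (B : H →ₗ[ℂ] H).rank :=
  LinearMap.rank_comp_le_right (B : H →ₗ[ℂ] H) (A : H →ₗ[ℂ] H)

lemma rank_add_le_of_le {A B : H →L[ℂ] H} {m n : ℕ} (hA : (A : H →ₗ[ℂ] H).rank ≤ m)
    (hB : (B : H →ₗ[ℂ] H).rank ≤ n) : ((A + B : H →L[ℂ] H) : H →ₗ[ℂ] H).rank ≤ (m + n : ℕ) := by
  push_cast
  exact (LinearMap.rank_add_le _ _).trans (add_le_add hA hB)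

lemma rank_commutator_le (T : H →L[ℂ] H) {A : H →L[ℂ] H} {m : ℕ}
    (hA : (A : H →ₗ[ℂ] H).rank ≤ m) :
    ((T * A - A * T : H →L[ℂ] H) : H →ₗ[ℂ] H).rank ≤ (2 * m : ℕ) := by
  have : T * A - A * T = T * A + A * (-T) := by rw [mul_neg, sub_eq_add_neg]
  rw [this, two_mul]
  exact rank_add_le_of_le ((rank_mul_le_right _ _).trans hA) ((rank_mul_le_left _ _).trans hA)

lemma norm_commutator_le (T A : H →L[ℂ] H) : ‖T * A - A * T‖ ≤ 2 * ‖T‖ * ‖A‖ := by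
  have h1 := norm_mul_le T A
  have h2 := norm_mul_le A T
  have h3 := norm_sub_le (T * A) (A * T)
  linarith

lemma rank_starProjection_le (K : Submodule ℂ H) [FiniteDimensional ℂ K] :
    (K.starProjection : H →ₗ[ℂ] H).rank ≤ Module.finrank ℂ K := by
  unfold LinearMap.rank
  rw [Submodule.range_starProjection, Module.finrank_eq_rank]

/-! ### The directed set of finite rank contractions -/

/-- A contraction lies below every projection onto a subspace containing its range. -/
lemma le_starProjection_of_range_le {A : H →L[ℂ] H} (h0 : 0 ≤ A) (h1 : A ≤ 1)
    {K : Submodule ℂ H} [K.HasOrthogonalProjection] (hK : LinearMap.range (A : H →ₗ[ℂ] H) ≤ K) :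
    A ≤ K.starProjection := by
  set Q := K.starProjection
  have hQ : IsStarProjection Q := isStarProjection_starProjection
  have hQA : Q * A = A := by
    ext x
    exact Submodule.starProjection_eq_self_iff.2 (hK ⟨x, rfl⟩)
  have hAQ : A * Q = A := by
    have := congrArg star hQA
    rwa [star_mul, hQ.isSelfAdjoint.star_eq, (IsSelfAdjoint.of_nonneg h0).star_eq] at this
  have h := star_left_conjugate_le_conjugate h1 Q
  rwa [hQ.isSelfAdjoint.star_eq, hQA, hAQ, mul_one, hQ.isIdempotentElem.eq] at h

/-- The projection onto a finite-dimensional subspace. -/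
def finiteProjection (K : Submodule ℂ H) [FiniteDimensional ℂ K] : FiniteRankContraction H :=
  ⟨K.starProjection, isStarProjection_starProjection.nonneg,
    isStarProjection_starProjection.le_one, by
      rw [Submodule.range_starProjection]; infer_instance⟩

instance : Nonempty (FiniteRankContraction H) := ⟨finiteProjection ⊥⟩

instance : IsDirectedOrder (FiniteRankContraction H) := by
  refine ⟨fun A B => ?_⟩
  have := A.2.2.2
  have := B.2.2.2
  refine ⟨finiteProjection (LinearMap.range (A.1 : H →ₗ[ℂ] H) ⊔ LinearMap.range (B.1 : H →ₗ[ℂ] H)),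
    ?_, ?_⟩
  · exact le_starProjection_of_range_le A.2.1 A.2.2.1 le_sup_left
  · exact le_starProjection_of_range_le B.2.1 B.2.2.1 le_sup_right

lemma quasicentralModulus_le {φ : Fin 2 → (ℕ →₀ ℝ) → ℝ} {c : ℝ≥0∞}
    (h : ∀ A₀ : FiniteRankContraction H, ∃ A ≥ A₀, hybridNorm φ (tupleCommutator τ A.1) ≤ c) :
    quasicentralModulus φ τ ≤ c :=
  liminf_le_of_frequently_le' (frequently_atTop.2 h)

/-- A projection `P` almost fixing the range of `Q` is corrected to the positive contraction
`A = 1 - (1 - Q)(1 - P)(1 - Q)`, which lies above `Q` and differs from `P` by a small operator of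
rank at most twice that of `Q`. -/
lemma exists_ge_of_isStarProjection (K : Submodule ℂ H) [FiniteDimensional ℂ K] {P : H →L[ℂ] H}
    (hP : IsStarProjection P) [FiniteDimensional ℂ (LinearMap.range (P : H →ₗ[ℂ] H))] {η : ℝ}
    (hη : ‖(1 - P) * K.starProjection‖ ≤ η) :
    ∃ A : FiniteRankContraction H, finiteProjection K ≤ A ∧ ‖A.1 - P‖ ≤ 2 * η ∧
      ((A.1 - P : H →L[ℂ] H) : H →ₗ[ℂ] H).rank ≤ (2 * Module.finrank ℂ K : ℕ) := by
  set Q := K.starProjection with hQdef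
  have hQ : IsStarProjection Q := isStarProjection_starProjection
  have hQQ : Q * Q = Q := hQ.isIdempotentElem.eq
  have hQrank : (Q : H →ₗ[ℂ] H).rank ≤ Module.finrank ℂ K := rank_starProjection_le K
  set A : H →L[ℂ] H := 1 - (1 - Q) * (1 - P) * (1 - Q) with hA
  have hs : star (1 - Q) = 1 - Q := hQ.one_sub.isSelfAdjoint.star_eq
  have h1 : (1 - Q) * (1 - P) * (1 - Q) ≤ 1 - Q := by
    have h := star_left_conjugate_le_conjugate (sub_le_self 1 hP.nonneg) (1 - Q)
    rwa [hs, mul_one, hQ.one_sub.isIdempotentElem.eq] at h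
  have h2 : 0 ≤ (1 - Q) * (1 - P) * (1 - Q) := by
    have h := star_left_conjugate_nonneg hP.one_sub_nonneg (1 - Q)
    rwa [hs] at h
  have hdiff : A - P = Q * (1 - P) + (1 - Q) * ((1 - P) * Q) := by
    have e1 : (1 - Q) * (1 - P) * (1 - Q)
        = 1 - Q - P + Q * P - (1 - P) * Q + Q * ((1 - P) * Q) := by noncomm_ring
    rw [hA, e1]
    noncomm_ring
  have hrank : ((A - P : H →L[ℂ] H) : H →ₗ[ℂ] H).rank ≤ (2 * Module.finrank ℂ K : ℕ) := by
    rw [hdiff, two_mul]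
    exact rank_add_le_of_le ((rank_mul_le_left _ _).trans hQrank)
      ((rank_mul_le_right _ _).trans ((rank_mul_le_right _ _).trans hQrank))
  have hQA : Q ≤ A := by
    have := sub_le_sub_left h1 1
    rwa [sub_sub_cancel] at this
  have hfin : FiniteDimensional ℂ (LinearMap.range (A : H →ₗ[ℂ] H)) := by
    have h3 : (A : H →ₗ[ℂ] H).rank < Cardinal.aleph0 := by
      have : A = (A - P) + P := (sub_add_cancel A P).symm
      rw [this]
      refine (LinearMap.rank_add_le _ _).trans_lt (Cardinal.add_lt_aleph0 ?_ ?_)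
      · exact hrank.trans_lt Cardinal.natCast_lt_aleph0
      · exact Module.rank_lt_aleph0_iff.2 inferInstance
    exact Module.rank_lt_aleph0_iff.1 h3
  refine ⟨⟨A, hQ.nonneg.trans hQA, sub_le_self 1 h2, hfin⟩, hQA, ?_, hrank⟩
  have hη' : ‖Q * (1 - P)‖ ≤ η := by
    rw [← norm_star, star_mul, hQ.isSelfAdjoint.star_eq, hP.one_sub.isSelfAdjoint.star_eq]
    exact hη
  have h4 : ‖(1 - Q) * ((1 - P) * Q)‖ ≤ η := by
    refine (norm_mul_le _ _).trans ?_
    have := mul_le_mul hQ.one_sub.norm_le hη (norm_nonneg _) zero_le_one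
    rwa [one_mul] at this
  change ‖A - P‖ ≤ _
  rw [hdiff]
  linarith [norm_add_le (Q * (1 - P)) ((1 - Q) * ((1 - P) * Q))]

variable {w : ℕ → ℝ}

/-- Upper bound for the commutator of a contraction above `A₀`, given a projection `P` of rank `r`
that almost fixes the range of `A₀` and almost commutes with `τ`. -/
lemma exists_ge_hybridNorm_le (hpos : ∀ j, 0 < w j) (hanti : Antitone w)
    (A₀ : FiniteRankContraction H) {K : Submodule ℂ H} [FiniteDimensional ℂ K]
    (hK : LinearMap.range (A₀.1 : H →ₗ[ℂ] H) ≤ K) {P : H →L[ℂ] H} (hP : IsStarProjection P)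
    {r m : ℕ} (hr : 0 < r) (hPr : (P : H →ₗ[ℂ] H).rank ≤ r) {δ : Fin 2 → ℝ}
    (hδ : ∀ j, ‖τ j * P - P * τ j‖ ≤ δ j) {η M c : ℝ}
    (hη : ‖(1 - P) * K.starProjection‖ ≤ η) (hM : 4 * ‖τ‖ * η ≤ M)
    (hm : 4 * Module.finrank ℂ K ≤ m)
    (h0 : M * (∑ j ∈ Finset.range m, w j) + δ 0 * ∑ j ∈ Finset.range (2 * r + m), w j ≤ c)
    (h1 : M * (m / w 0) + δ 1 * ((2 * r + m : ℕ) / ∑ j ∈ Finset.range (2 * r + m), w j) ≤ c) :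
    ∃ A ≥ A₀, hybridNorm (lorentzPair w) (tupleCommutator τ A.1) ≤ ENNReal.ofReal c := by
  have : FiniteDimensional ℂ (LinearMap.range (P : H →ₗ[ℂ] H)) :=
    Module.rank_lt_aleph0_iff.1 (hPr.trans_lt Cardinal.natCast_lt_aleph0)
  obtain ⟨A, hKA, hAP, hAPr⟩ := exists_ge_of_isStarProjection K hP hη
  refine ⟨A, (le_starProjection_of_range_le A₀.2.1 A₀.2.2.1 hK).trans hKA, ?_⟩
  have hsplit : tupleCommutator τ A.1
      = fun j => (τ j * P - P * τ j) + (τ j * (A.1 - P) - (A.1 - P) * τ j) := by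
    funext j
    unfold tupleCommutator
    noncomm_ring
  rw [hsplit]
  refine hybridNorm_lorentzPair_le hpos hanti (M := M) (p := 2 * r) (m := m) (by omega) hδ
    (fun j => rank_commutator_le _ hPr) (fun j => ?_) (fun j => ?_) h0 h1
  · refine (norm_commutator_le _ _).trans (le_trans ?_ hM)
    have := mul_le_mul (norm_le_pi_norm τ j) hAP (norm_nonneg _) (norm_nonneg τ)
    linarith
  · refine (rank_commutator_le _ hAPr).trans ?_
    have : 2 * (2 * Module.finrank ℂ K) ≤ m := by omega
    exact_mod_cast this

/-! ### Projections subordinate to a family of orthogonal spectral subspaces -/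

variable {ι : Type*} [Fintype ι]

lemma norm_sum_sq_of_pairwise_orthogonal {d : ι → H} (hd : ∀ i j, i ≠ j → ⟪d i, d j⟫_ℂ = 0) :
    ‖∑ i, d i‖ ^ 2 = ∑ i, ‖d i‖ ^ 2 := by
  classical
  have h : ⟪∑ i, d i, ∑ i, d i⟫_ℂ = ∑ i, ⟪d i, d i⟫_ℂ := by
    rw [sum_inner]
    refine Finset.sum_congr rfl fun i _ => ?_
    rw [inner_sum]
    exact Finset.sum_eq_single i (fun j _ hj => hd i j hj.symm) (by simp)
  have h2 := congrArg Complex.re h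
  rw [Complex.re_sum] at h2
  have hn : ∀ x : H, ‖x‖ ^ 2 = (⟪x, x⟫_ℂ).re := fun x => (inner_self_eq_norm_sq (𝕜 := ℂ) x).symm
  simp only [hn]
  exact h2

/-- The projection onto the sum of the subspaces `E i V`, which are orthogonal to each other if
the operators `E i` are. -/
def sumProjection (E : ι → H →L[ℂ] H) (V : Submodule ℂ H) [FiniteDimensional ℂ V] : H →L[ℂ] H :=
  ∑ i, (V.map (E i : H →ₗ[ℂ] H)).starProjection

section sumProjection

variable {E : ι → H →L[ℂ] H} {V : Submodule ℂ H} [FiniteDimensional ℂ V]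

lemma isOrtho_map (hE : ∀ i, IsSelfAdjoint (E i)) (hEE : ∀ i j, i ≠ j → E i * E j = 0)
    {i j : ι} (hij : i ≠ j) (x y : H) : ⟪E i x, E j y⟫_ℂ = 0 := by
  rw [inner_apply_left_of_isSelfAdjoint (hE i), ← mul_apply_eq_comp, hEE i j hij]
  simp

lemma starProjection_map_mul_eq_zero (hE : ∀ i, IsSelfAdjoint (E i))
    (hEE : ∀ i j, i ≠ j → E i * E j = 0) {i j : ι} (hij : i ≠ j) :
    (V.map (E i : H →ₗ[ℂ] H)).starProjection * (V.map (E j : H →ₗ[ℂ] H)).starProjection = 0 := by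
  refine Submodule.IsOrtho.starProjection_comp_starProjection ?_
  rw [Submodule.isOrtho_iff_inner_eq]
  rintro _ ⟨x, -, rfl⟩ _ ⟨y, -, rfl⟩
  exact isOrtho_map hE hEE hij x y

lemma isStarProjection_sumProjection (hE : ∀ i, IsSelfAdjoint (E i))
    (hEE : ∀ i j, i ≠ j → E i * E j = 0) : IsStarProjection (sumProjection E V) := by
  classical
  refine ⟨?_, ?_⟩
  · unfold IsIdempotentElem sumProjection
    rw [Finset.sum_mul]
    refine Finset.sum_congr rfl fun i _ => ?_
    rw [Finset.mul_sum, Finset.sum_eq_single i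
      (fun j _ hj => starProjection_map_mul_eq_zero hE hEE hj.symm) (by simp)]
    exact (isStarProjection_starProjection (U := V.map (E i : H →ₗ[ℂ] H))).isIdempotentElem.eq
  · exact isSelfAdjoint_sum _ fun i _ => isStarProjection_starProjection.isSelfAdjoint

lemma rank_sumProjection_le :
    (sumProjection E V : H →ₗ[ℂ] H).rank ≤ (Fintype.card ι * Module.finrank ℂ V : ℕ) := by
  classical
  have h : ∀ s : Finset ι, ((∑ i ∈ s, (V.map (E i : H →ₗ[ℂ] H)).starProjection : H →L[ℂ] H) :
      H →ₗ[ℂ] H).rank ≤ (s.card * Module.finrank ℂ V : ℕ) := by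
    intro s
    induction s using Finset.induction_on with
    | empty => simp
    | insert a s ha ih =>
      rw [Finset.sum_insert ha, Finset.card_insert_of_notMem ha, add_mul, one_mul, add_comm]
      refine rank_add_le_of_le ih ((rank_starProjection_le _).trans ?_)
      exact_mod_cast Submodule.finrank_map_le (E a : H →ₗ[ℂ] H) V
  exact h Finset.univ

lemma sumProjection_apply_mem (hE : ∀ i, IsSelfAdjoint (E i))
    (hEE : ∀ i j, i ≠ j → E i * E j = 0) {ξ : H} (hξ : ξ ∈ V) (i : ι) :
    sumProjection E V (E i ξ) = E i ξ := by
  classical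
  have hmem : E i ξ ∈ V.map (E i : H →ₗ[ℂ] H) := ⟨ξ, hξ, rfl⟩
  have hfix := Submodule.starProjection_eq_self_iff.2 hmem
  unfold sumProjection
  rw [sum_apply, Finset.sum_eq_single i _ (by simp), hfix]
  intro j _ hj
  rw [← hfix, ← mul_apply_eq_comp, starProjection_map_mul_eq_zero hE hEE hj]
  simp

/-- If `T` commutes with the `E i` and is within `δ` of a constant on each `E i V`, then it almost
commutes with the projection onto their sum. Indeed `[T, P] = D - D*` with
`D = ∑ i, (T - a i) P i`, whose summands have orthogonal ranges and orthogonal initial spaces. -/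
lemma norm_commutator_sumProjection_le (hE : ∀ i, IsSelfAdjoint (E i))
    (hEE : ∀ i j, i ≠ j → E i * E j = 0) {T : H →L[ℂ] H} (hT : IsSelfAdjoint T)
    (hTE : ∀ i, Commute T (E i)) {a : ι → ℝ} {δ : ℝ} (hδ : 0 ≤ δ)
    (hTδ : ∀ i ζ, ‖(T - (a i : ℂ) • 1) (E i ζ)‖ ≤ δ * ‖E i ζ‖) :
    ‖T * sumProjection E V - sumProjection E V * T‖ ≤ 2 * δ := by
  set P : ι → H →L[ℂ] H := fun i => (V.map (E i : H →ₗ[ℂ] H)).starProjection with hPdef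
  have hPsa : ∀ i, IsSelfAdjoint (P i) := fun i => isStarProjection_starProjection.isSelfAdjoint
  have hPE : ∀ i x, ∃ ζ, P i x = E i ζ := by
    intro i x
    obtain ⟨ζ, -, hζ⟩ := Submodule.starProjection_apply_mem (V.map (E i : H →ₗ[ℂ] H)) x
    exact ⟨ζ, hζ.symm⟩
  have hTE' : ∀ i ζ, (T - (a i : ℂ) • 1) (E i ζ) = E i ((T - (a i : ℂ) • 1) ζ) := by
    intro i ζ
    have : T (E i ζ) = E i (T ζ) := DFunLike.congr_fun (hTE i) ζ
    simp [this]
  set D : H →L[ℂ] H := ∑ i, (T - (a i : ℂ) • 1) * P i with hD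
  have hDstar : star D = ∑ i, P i * (T - (a i : ℂ) • 1) := by
    rw [hD, star_sum]
    refine Finset.sum_congr rfl fun i _ => ?_
    rw [star_mul, (hPsa i).star_eq, star_sub, hT.star_eq, star_smul, star_one]
    simp
  have hcomm : T * sumProjection E V - sumProjection E V * T = D - star D := by
    rw [hDstar, hD, ← Finset.sum_sub_distrib]
    unfold sumProjection
    rw [Finset.mul_sum, Finset.sum_mul, ← Finset.sum_sub_distrib]
    refine Finset.sum_congr rfl fun i _ => ?_
    simp only [sub_mul, mul_sub, smul_mul_assoc, mul_smul_comm, one_mul, mul_one]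
    abel
  have hnorm : ‖D‖ ≤ δ := by
    refine ContinuousLinearMap.opNorm_le_bound _ hδ fun x => ?_
    have hDx : D x = ∑ i, (T - (a i : ℂ) • 1) (P i x) := by rw [hD, sum_apply]; rfl
    have hPx : sumProjection E V x = ∑ i, P i x := by unfold sumProjection; rw [sum_apply]
    have h1 : ‖D x‖ ^ 2 = ∑ i, ‖(T - (a i : ℂ) • 1) (P i x)‖ ^ 2 := by
      rw [hDx]
      refine norm_sum_sq_of_pairwise_orthogonal fun i j hij => ?_
      obtain ⟨ζ, hζ⟩ := hPE i x
      obtain ⟨ζ', hζ'⟩ := hPE j x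
      rw [hζ, hζ', hTE', hTE']
      exact isOrtho_map hE hEE hij _ _
    have h2 : ‖sumProjection E V x‖ ^ 2 = ∑ i, ‖P i x‖ ^ 2 := by
      rw [hPx]
      refine norm_sum_sq_of_pairwise_orthogonal fun i j hij => ?_
      obtain ⟨ζ, hζ⟩ := hPE i x
      obtain ⟨ζ', hζ'⟩ := hPE j x
      rw [hζ, hζ']
      exact isOrtho_map hE hEE hij _ _
    have h3 : ‖sumProjection E V x‖ ≤ ‖x‖ := by
      refine (ContinuousLinearMap.le_opNorm _ _).trans ?_
      exact mul_le_of_le_one_left (norm_nonneg _) (isStarProjection_sumProjection hE hEE).norm_le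
    rw [← sq_le_sq₀ (norm_nonneg _) (by positivity), h1, mul_pow]
    calc ∑ i, ‖(T - (a i : ℂ) • 1) (P i x)‖ ^ 2 ≤ ∑ i, δ ^ 2 * ‖P i x‖ ^ 2 := by
          refine Finset.sum_le_sum fun i _ => ?_
          obtain ⟨ζ, hζ⟩ := hPE i x
          rw [hζ, ← mul_pow]
          exact pow_le_pow_left₀ (norm_nonneg _) (hTδ i ζ) 2
      _ = δ ^ 2 * ‖sumProjection E V x‖ ^ 2 := by rw [h2, Finset.mul_sum]
      _ ≤ δ ^ 2 * ‖x‖ ^ 2 := by gcongr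
  rw [hcomm]
  calc ‖D - star D‖ ≤ ‖D‖ + ‖star D‖ := norm_sub_le _ _
    _ = 2 * ‖D‖ := by rw [norm_star, two_mul]
    _ ≤ 2 * δ := by linarith

end sumProjection

end Contraction

/-! ### Grids -/

section Grid

variable {H : Type u} [NormedAddCommGroup H] [InnerProductSpace ℂ H] [CompleteSpace H]
open Filter MeasureTheory Topology
variable {τ : Fin 2 → H →L[ℂ] H}

/-- The cells of the subdivision of `[-R, R)²` into `N 0 × N 1` congruent half-open boxes. -/
def cell (R : ℝ) (N : Fin 2 → ℕ) (p : ∀ j, Fin (N j)) : Set (Fin 2 → ℝ) :=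
  box (fun j => -R + (p j : ℕ) * (2 * R / N j)) (fun j => -R + ((p j : ℕ) + 1) * (2 * R / N j))

section cell

variable {R : ℝ} {N : Fin 2 → ℕ}

lemma measurableSet_cell (R : ℝ) (N : Fin 2 → ℕ) (p : ∀ j, Fin (N j)) :
    MeasurableSet (cell R N p) := measurableSet_box _ _

lemma mem_cell {p : ∀ j, Fin (N j)} {x : Fin 2 → ℝ} : x ∈ cell R N p ↔
    ∀ j, -R + (p j : ℕ) * (2 * R / N j) ≤ x j ∧ x j < -R + ((p j : ℕ) + 1) * (2 * R / N j) := by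
  simp [cell, box, Set.mem_Ico]

lemma mem_cell_iff_floor (hR : 0 < R) (hN : ∀ j, 0 < N j) {p : ∀ j, Fin (N j)} {x : Fin 2 → ℝ} :
    x ∈ cell R N p ↔ ∀ j, ⌊(x j + R) / (2 * R / N j)⌋ = ((p j : ℕ) : ℤ) := by
  rw [mem_cell]
  refine forall_congr' fun j => ?_
  have h : 0 < 2 * R / N j := div_pos (by linarith) (by exact_mod_cast hN j)
  rw [Int.floor_eq_iff, le_div_iff₀ h, div_lt_iff₀ h]
  push_cast
  constructor <;> rintro ⟨h1, h2⟩ <;> constructor <;> linarith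

lemma disjoint_cell (hR : 0 < R) (hN : ∀ j, 0 < N j) {p q : ∀ j, Fin (N j)} (hpq : p ≠ q) :
    Disjoint (cell R N p) (cell R N q) := by
  rw [Set.disjoint_left]
  intro x hp hq
  rw [mem_cell_iff_floor hR hN] at hp hq
  refine hpq (funext fun j => Fin.ext ?_)
  exact_mod_cast (hp j).symm.trans (hq j)

lemma exists_mem_cell (hR : 0 < R) (hN : ∀ j, 0 < N j) {x : Fin 2 → ℝ}
    (hx : x ∈ Metric.ball (0 : Fin 2 → ℝ) R) : ∃ p, x ∈ cell R N p := by
  have hlt : ∀ j, |x j| < R := fun j =>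
    (norm_le_pi_norm x j).trans_lt (mem_ball_zero_iff.1 hx)
  have hb : ∀ j, 0 ≤ ⌊(x j + R) / (2 * R / N j)⌋ ∧ ⌊(x j + R) / (2 * R / N j)⌋ < (N j : ℤ) := by
    intro j
    have h := abs_lt.1 (hlt j)
    have hNj : (0 : ℝ) < N j := by exact_mod_cast hN j
    have h0 : 0 < 2 * R / N j := div_pos (by linarith) hNj
    constructor
    · exact Int.floor_nonneg.2 (div_nonneg (by linarith) h0.le)
    · rw [Int.floor_lt, div_lt_iff₀ h0]
      have : ((N j : ℤ) : ℝ) * (2 * R / N j) = 2 * R := by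
        push_cast; field_simp
      rw [this]; linarith
  refine ⟨fun j => ⟨⌊(x j + R) / (2 * R / N j)⌋.toNat, ?_⟩, ?_⟩
  · have := hb j; omega
  · rw [mem_cell_iff_floor hR hN]
    intro j
    exact (Int.toNat_of_nonneg (hb j).1).symm

lemma abs_sub_center_le {p : ∀ j, Fin (N j)} {x : Fin 2 → ℝ} (hx : x ∈ cell R N p) (j : Fin 2) :
    |x j - (-R + ((p j : ℕ) + 1 / 2) * (2 * R / N j))| ≤ R / N j := by
  have h := mem_cell.1 hx j
  have e : 2 * R / N j = 2 * (R / N j) := by ring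
  rw [e] at h ⊢
  rw [abs_le]
  constructor <;> linarith

lemma dist_le_of_mem_cell (hR : 0 ≤ R) {p : ∀ j, Fin (N j)} {x y : Fin 2 → ℝ}
    (hx : x ∈ cell R N p) (hy : y ∈ cell R N p) : dist x y ≤ 2 * R / N 0 + 2 * R / N 1 := by
  have h0 : 0 ≤ 2 * R / N 0 := by positivity
  have h1 : 0 ≤ 2 * R / N 1 := by positivity
  refine (dist_pi_le_iff (add_nonneg h0 h1)).2 fun j => ?_
  have hle : 2 * R / N j ≤ 2 * R / N 0 + 2 * R / N 1 := by
    fin_cases j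
    · exact le_add_of_nonneg_right h1
    · exact le_add_of_nonneg_left h0
  refine le_trans ?_ hle
  have a := mem_cell.1 hx j
  have b := mem_cell.1 hy j
  rw [Real.dist_eq, abs_le]
  constructor <;> linarith

lemma volume_cell (p : ∀ j, Fin (N j)) :
    volume (cell R N p) = ENNReal.ofReal (2 * R / N 0) * ENNReal.ofReal (2 * R / N 1) := by
  unfold cell box
  rw [Real.volume_pi_Ico, Fin.prod_univ_two]
  congr 2 <;> ring

/-- Cells meeting `L` are disjoint subsets of a neighbourhood of `L`. -/
lemma card_mul_le_volume_cthickening (hR : 0 < R) (hN : ∀ j, 0 < N j) {L : Set (Fin 2 → ℝ)}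
    {S : Finset (∀ j, Fin (N j))} (hS : ∀ p ∈ S, (cell R N p ∩ L).Nonempty) :
    S.card * (ENNReal.ofReal (2 * R / N 0) * ENNReal.ofReal (2 * R / N 1))
      ≤ volume (Metric.cthickening (2 * R / N 0 + 2 * R / N 1) L) := by
  have h1 : volume (⋃ p ∈ S, cell R N p)
      = S.card * (ENNReal.ofReal (2 * R / N 0) * ENNReal.ofReal (2 * R / N 1)) := by
    rw [measure_biUnion_finset (fun p _ q _ hpq => disjoint_cell hR hN hpq)
      (fun p _ => measurableSet_cell R N p)]
    simp only [volume_cell, Finset.sum_const, nsmul_eq_mul]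
  rw [← h1]
  refine measure_mono (Set.iUnion₂_subset fun p hp x hx => ?_)
  obtain ⟨y, hy, hyL⟩ := hS p hp
  exact Metric.mem_cthickening_of_dist_le x y _ _ hyL (dist_le_of_mem_cell hR.le hx hy)

end cell

/-! ### Projections subordinate to a grid -/

/-- The projection onto the span of the spectral parts in the cells `p ∈ S` of the vectors of
a finite-dimensional space `V`. -/
lemma exists_gridProjection (hτ : IsCommutingHermitian τ) {R : ℝ} (hR : 0 < R) {N : Fin 2 → ℕ}
    (hN : ∀ j, 0 < N j) (S : Finset (∀ j, Fin (N j))) (V : Submodule ℂ H)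
    [FiniteDimensional ℂ V] :
    ∃ P : H →L[ℂ] H, IsStarProjection P ∧
      (P : H →ₗ[ℂ] H).rank ≤ (S.card * Module.finrank ℂ V : ℕ) ∧
      (∀ j, ‖τ j * P - P * τ j‖ ≤ 2 * (R / N j)) ∧
      ∀ ξ ∈ V, ‖(1 - P) ξ‖ ^ 2
        ≤ ‖ξ‖ ^ 2 - (scalarSpectralMeasure τ ξ).real (⋃ p ∈ S, cell R N p) := by
  have hex : ∀ p : S, ∃ E, IsSpectralProjection τ (cell R N p) E := fun p =>
    exists_isSpectralProjection_box τ _ _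
  choose E hE using hex
  have hmeas : ∀ p : S, MeasurableSet (cell R N p) := fun p => measurableSet_cell R N p
  have hsa : ∀ p, IsSelfAdjoint (E p) := fun p => (hE p).isSelfAdjoint
  have hEE : ∀ p q, p ≠ q → E p * E q = 0 := fun p q hpq =>
    (hE p).mul_eq_zero (hmeas q) (hE q) (disjoint_cell hR hN fun h => hpq (Subtype.ext h))
  have hP := isStarProjection_sumProjection (V := V) hsa hEE
  refine ⟨sumProjection E V, hP, ?_, fun j => ?_, fun ξ hξ => ?_⟩
  · simpa using rank_sumProjection_le (E := E) (V := V)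
  · have hδ : 0 ≤ R / N j := by positivity
    exact norm_commutator_sumProjection_le hsa hEE (hτ.1 j) (fun p => (hE p).commute hτ j) hδ
      (a := fun p : S => -R + (((p : ∀ j, Fin (N j)) j : ℕ) + 1 / 2) * (2 * R / N j))
      fun p ζ => (hE p).norm_sub_smul_apply_le hτ (hmeas p) hδ
        (fun x hx => abs_sub_center_le hx j) ζ
  · set μ := scalarSpectralMeasure τ ξ
    have hμ : ∑ p, μ.real (cell R N (p : S)) = μ.real (⋃ p ∈ S, cell R N p) := by
      rw [measureReal_biUnion_finset (fun p _ q _ hpq => disjoint_cell hR hN hpq)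
        (fun p _ => measurableSet_cell R N p)]
      exact Finset.sum_coe_sort S fun p => μ.real (cell R N p)
    have h1 : ‖ξ - ∑ p, E p ξ‖ ^ 2 = ‖ξ‖ ^ 2 - μ.real (⋃ p ∈ S, cell R N p) := by
      rw [norm_sub_sq (𝕜 := ℂ), inner_sum, map_sum, norm_sum_sq_of_pairwise_orthogonal
        fun p q hpq => isOrtho_map hsa hEE hpq ξ ξ]
      have a : ∀ p, RCLike.re ⟪ξ, E p ξ⟫_ℂ = μ.real (cell R N (p : S)) := fun p =>
        (hE p).inner_apply_self (hmeas p) ξ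
      have b : ∀ p, ‖E p ξ‖ ^ 2 = μ.real (cell R N (p : S)) := fun p =>
        (hE p).norm_apply_sq hτ (hmeas p) ξ
      simp only [a, b, hμ]
      ring
    have h2 : (1 - sumProjection E V) ξ = (1 - sumProjection E V) (ξ - ∑ p, E p ξ) := by
      have : (1 - sumProjection E V) (∑ p, E p ξ) = 0 := by
        rw [map_sum]
        refine Finset.sum_eq_zero fun p _ => ?_
        rw [sub_apply, sumProjection_apply_mem hsa hEE hξ p]
        simp
      rw [map_sub, this, sub_zero]
    rw [← h1, h2]
    refine pow_le_pow_left₀ (norm_nonneg _) ?_ 2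
    exact (ContinuousLinearMap.le_opNorm _ _).trans
      (mul_le_of_le_one_left (norm_nonneg _) hP.one_sub.norm_le)

lemma norm_mul_starProjection_le (B : H →L[ℂ] H) (K : Submodule ℂ H) [FiniteDimensional ℂ K] :
    ‖B * K.starProjection‖ ≤ ∑ i, ‖B (stdOrthonormalBasis ℂ K i : H)‖ := by
  set b := stdOrthonormalBasis ℂ K
  refine ContinuousLinearMap.opNorm_le_bound _ (Finset.sum_nonneg fun _ _ => norm_nonneg _)
    fun x => ?_
  have h : K.starProjection x = ∑ i, ⟪(b i : H), x⟫_ℂ • (b i : H) := by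
    have := congrArg (Subtype.val) (b.sum_repr' (K.orthogonalProjectionOnto x))
    rw [Submodule.starProjection_apply, ← this]
    simp
  rw [mul_apply_eq_comp, h, map_sum, Finset.sum_mul]
  refine (norm_sum_le _ _).trans (Finset.sum_le_sum fun i _ => ?_)
  rw [map_smul, norm_smul, mul_comm]
  refine mul_le_mul_of_nonneg_left ?_ (norm_nonneg _)
  refine (norm_inner_le_norm _ _).trans ?_
  have : ‖(b i : H)‖ = 1 := b.norm_eq_one i
  rw [this, one_mul]

/-- Projections that asymptotically commute with `τ` and fix a cyclic vector converge strongly to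
the identity: the vectors at which they do form a closed subspace invariant under `τ`. -/
lemma tendsto_of_isCyclicVector {ξ : H} (hξ : IsCyclicVector τ ξ) {P : ℕ → H →L[ℂ] H}
    (hP : ∀ n, IsStarProjection (P n))
    (hcomm : ∀ j, Tendsto (fun n => ‖τ j * P n - P n * τ j‖) atTop (𝓝 0))
    (hfix : ∀ n, (1 - P n) ξ = 0) (η : H) :
    Tendsto (fun n => ‖(1 - P n) η‖) atTop (𝓝 0) := by
  have hle : ∀ n x, ‖(1 - P n) x‖ ≤ ‖x‖ := fun n x =>
    (ContinuousLinearMap.le_opNorm _ _).trans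
      (mul_le_of_le_one_left (norm_nonneg _) (hP n).one_sub.norm_le)
  let G : H → Prop := fun x => Tendsto (fun n => (1 - P n) x) atTop (𝓝 0)
  have hstep : ∀ j x, G x → G (τ j x) := by
    intro j x hx
    have e : ∀ n, (1 - P n) (τ j x) = τ j ((1 - P n) x) + (τ j * P n - P n * τ j) x := by
      intro n; simp
    have h1 : Tendsto (fun n => τ j ((1 - P n) x)) atTop (𝓝 0) := by
      have := ((τ j).continuous.tendsto 0).comp hx
      rwa [map_zero] at this
    have h2 : Tendsto (fun n => (τ j * P n - P n * τ j) x) atTop (𝓝 0) := by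
      refine squeeze_zero_norm (fun n => ContinuousLinearMap.le_opNorm _ _) ?_
      simpa using (hcomm j).mul_const ‖x‖
    have h3 := h1.add h2
    rw [add_zero] at h3
    exact h3.congr fun n => (e n).symm
  have halg : ∀ A ∈ Algebra.adjoin ℂ (Set.range τ), ∀ x, G x → G (A x) := by
    intro A hA
    induction hA using Algebra.adjoin_induction with
    | mem A hA =>
      obtain ⟨j, rfl⟩ := hA
      exact hstep j
    | algebraMap c =>
      intro x hx
      have := Tendsto.const_smul hx c
      rw [smul_zero] at this
      refine this.congr fun n => ?_
      rw [Algebra.algebraMap_eq_smul_one]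
      simp [smul_sub]
    | add A B _ _ ihA ihB =>
      intro x hx
      have := (ihA x hx).add (ihB x hx)
      rw [add_zero] at this
      refine this.congr fun n => ?_
      rw [add_apply, map_add]
    | mul A B _ _ ihA ihB =>
      intro x hx
      exact ihA _ (ihB x hx)
  have hGξ : G ξ := by
    refine tendsto_const_nhds.congr fun n => (hfix n).symm
  rw [Metric.tendsto_atTop]
  intro ε hε
  obtain ⟨_, ⟨A, hA, rfl⟩, hdist⟩ := hξ.exists_dist_lt η (half_pos hε)
  have hG := halg A hA ξ hGξ
  obtain ⟨n₀, hn₀⟩ := Metric.tendsto_atTop.1 hG (ε / 2) (half_pos hε)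
  refine ⟨n₀, fun n hn => ?_⟩
  have h1 := hn₀ n hn
  rw [dist_zero_right] at h1
  rw [dist_zero_right, norm_norm]
  calc ‖(1 - P n) η‖ = ‖(1 - P n) (η - A ξ) + (1 - P n) (A ξ)‖ := by
        rw [← map_add, sub_add_cancel]
    _ ≤ ‖η - A ξ‖ + ‖(1 - P n) (A ξ)‖ := (norm_add_le _ _).trans (by gcongr; exact hle _ _)
    _ < ε := by rw [← dist_eq_norm]; linarith

end Grid

/-! ### Choice of the grid and upper bounds for the modulus -/

section Modulus

variable {H : Type u} [NormedAddCommGroup H] [InnerProductSpace ℂ H] [CompleteSpace H]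
open Filter MeasureTheory Topology
variable {τ : Fin 2 → H →L[ℂ] H}

variable {w : ℕ → ℝ}

/-- With `S n = w 0 + ⋯ + w (n - 1)`, the grid with about `κ S n` columns and `κ n / S n` rows. -/
def gridSize (w : ℕ → ℝ) (κ : ℝ) (n : ℕ) : Fin 2 → ℕ :=
  ![⌊κ * ∑ j ∈ Finset.range n, w j⌋₊ + 1, ⌊κ * (n / ∑ j ∈ Finset.range n, w j)⌋₊ + 1]

lemma gridSize_pos (w : ℕ → ℝ) (κ : ℝ) (n : ℕ) (j : Fin 2) : 0 < gridSize w κ n j := by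
  fin_cases j <;> exact Nat.succ_pos _

lemma lt_gridSize_zero (w : ℕ → ℝ) (κ : ℝ) (n : ℕ) :
    κ * ∑ j ∈ Finset.range n, w j < gridSize w κ n 0 := by
  have := Nat.lt_floor_add_one (κ * ∑ j ∈ Finset.range n, w j)
  simpa [gridSize] using this

lemma lt_gridSize_one (w : ℕ → ℝ) (κ : ℝ) (n : ℕ) :
    κ * (n / ∑ j ∈ Finset.range n, w j) < gridSize w κ n 1 := by
  have := Nat.lt_floor_add_one (κ * (n / ∑ j ∈ Finset.range n, w j))
  simpa [gridSize] using this

lemma eventually_gridSize_mul_le (hpos : ∀ j, 0 < w j)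
    (hlim : Tendsto w atTop (𝓝 0)) (hsum : ¬ Summable w) {κ : ℝ} (hκ : 0 < κ) :
    ∀ᶠ n : ℕ in atTop, (gridSize w κ n 0 : ℝ) * gridSize w κ n 1 ≤ 4 * κ ^ 2 * n := by
  filter_upwards [((tendsto_sum_range_atTop hpos hsum).const_mul_atTop hκ).eventually_ge_atTop 1,
    ((tendsto_div_sum_range_atTop hpos hlim).const_mul_atTop hκ).eventually_ge_atTop 1,
    eventually_gt_atTop 0] with n h0 h1 hn
  have hS := sum_range_pos hpos hn
  have a : (gridSize w κ n 0 : ℝ) ≤ 2 * (κ * ∑ j ∈ Finset.range n, w j) := by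
    have := Nat.floor_le (zero_le_one.trans h0)
    simp only [gridSize, Matrix.cons_val_zero, Nat.cast_add, Nat.cast_one]
    linarith
  have b : (gridSize w κ n 1 : ℝ) ≤ 2 * (κ * (n / ∑ j ∈ Finset.range n, w j)) := by
    have := Nat.floor_le (zero_le_one.trans h1)
    simp only [gridSize, Matrix.cons_val_one, Matrix.cons_val_fin_one, Nat.cast_add, Nat.cast_one]
    linarith
  refine (mul_le_mul a b (Nat.cast_nonneg _) (by linarith)).trans (le_of_eq ?_)
  field_simp
  ring

lemma tendsto_div_gridSize (hpos : ∀ j, 0 < w j) (hlim : Tendsto w atTop (𝓝 0))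
    (hsum : ¬ Summable w) {κ : ℝ} (hκ : 0 < κ) (R : ℝ) (j : Fin 2) :
    Tendsto (fun n => R / gridSize w κ n j) atTop (𝓝 0) := by
  refine Tendsto.const_div_atTop ?_ R
  fin_cases j
  · exact tendsto_atTop_mono (fun n => (lt_gridSize_zero w κ n).le)
      ((tendsto_sum_range_atTop hpos hsum).const_mul_atTop hκ)
  · exact tendsto_atTop_mono (fun n => (lt_gridSize_one w κ n).le)
      ((tendsto_div_sum_range_atTop hpos hlim).const_mul_atTop hκ)

lemma exists_pos_mul_le (hpos : ∀ j, 0 < w j) {c : ℝ} (hc : 0 < c) (m : ℕ) :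
    ∃ M > 0, M * (∑ j ∈ Finset.range m, w j) ≤ c ∧ M * (m / w 0) ≤ c := by
  have h1 : 0 ≤ ∑ j ∈ Finset.range m, w j := Finset.sum_nonneg fun j _ => (hpos j).le
  have h2 : 0 ≤ m / w 0 := div_nonneg (Nat.cast_nonneg m) (hpos 0).le
  have h3 : 0 < 1 + ∑ j ∈ Finset.range m, w j + m / w 0 := by linarith
  refine ⟨c / (1 + ∑ j ∈ Finset.range m, w j + m / w 0), div_pos hc h3, ?_, ?_⟩
  all_goals
    rw [div_mul_eq_mul_div, div_le_iff₀ h3]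
    exact mul_le_mul_of_nonneg_left (by linarith) hc.le

/-- A projection of rank `r`, with `2 r < n`, subordinate to the grid of parameters `κ` and `n`,
has commutators whose hybrid norm is of order `R / κ`: the first commutator has about `n` singular
numbers of size `R / (κ S n)`, the second about `n` of size `R S n / (κ n)`. -/
lemma exists_ge_of_gridSize (hpos : ∀ j, 0 < w j) (hanti : Antitone w)
    (A₀ : FiniteRankContraction H) {K : Submodule ℂ H} [FiniteDimensional ℂ K]
    (hK : LinearMap.range (A₀.1 : H →ₗ[ℂ] H) ≤ K) {P : H →L[ℂ] H} (hP : IsStarProjection P)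
    {κ R M η c : ℝ} {n r m : ℕ} (hκ : 0 < κ) (hR : 0 < R) (hr : 0 < r)
    (hPr : (P : H →ₗ[ℂ] H).rank ≤ r)
    (hPτ : ∀ j, ‖τ j * P - P * τ j‖ ≤ 2 * (R / gridSize w κ n j))
    (hη : ‖(1 - P) * K.starProjection‖ ≤ η) (hM : 4 * ‖τ‖ * η ≤ M)
    (hm : 4 * Module.finrank ℂ K ≤ m) (hn : 2 * r + m ≤ n)
    (h0 : M * (∑ j ∈ Finset.range m, w j) ≤ c / 2) (h1 : M * (m / w 0) ≤ c / 2)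
    (hc : 2 * R / κ ≤ c / 2) :
    ∃ A ≥ A₀, hybridNorm (lorentzPair w) (tupleCommutator τ A.1) ≤ ENNReal.ofReal c := by
  have hSq : 0 < ∑ j ∈ Finset.range (2 * r + m), w j := sum_range_pos hpos (by omega)
  have hS : 0 < ∑ j ∈ Finset.range n, w j := sum_range_pos hpos (by omega)
  have hn0 : (0 : ℝ) < n := by exact_mod_cast (show 0 < n by omega)
  have hN : ∀ j, (0 : ℝ) < gridSize w κ n j := fun j => by exact_mod_cast gridSize_pos w κ n j
  refine exists_ge_hybridNorm_le hpos hanti A₀ hK hP hr hPr hPτ hη hM hm ?_ ?_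
  · have h2 : 2 * (R / gridSize w κ n 0) * ∑ j ∈ Finset.range (2 * r + m), w j ≤ 2 * R / κ := by
      calc _ ≤ 2 * (R / gridSize w κ n 0) * ∑ j ∈ Finset.range n, w j :=
            mul_le_mul_of_nonneg_left (sum_range_mono hpos hn)
              (mul_nonneg zero_le_two (div_nonneg hR.le (hN 0).le))
        _ = 2 * R * (∑ j ∈ Finset.range n, w j) / gridSize w κ n 0 := by ring
        _ ≤ 2 * R / κ := by
            rw [div_le_div_iff₀ (hN 0) hκ]
            nlinarith [(lt_gridSize_zero w κ n).le]
    linarith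
  · have h3 : ((2 * r + m : ℕ) : ℝ) / ∑ j ∈ Finset.range (2 * r + m), w j
        ≤ n / ∑ j ∈ Finset.range n, w j := by
      rw [div_le_div_iff₀ hSq hS]
      exact mul_sum_range_le hanti hn
    have h2 : 2 * (R / gridSize w κ n 1) * ((2 * r + m : ℕ) / ∑ j ∈ Finset.range (2 * r + m), w j)
        ≤ 2 * R / κ := by
      calc _ ≤ 2 * (R / gridSize w κ n 1) * (n / ∑ j ∈ Finset.range n, w j) :=
            mul_le_mul_of_nonneg_left h3
              (mul_nonneg zero_le_two (div_nonneg hR.le (hN 1).le))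
        _ = 2 * R * (n / ∑ j ∈ Finset.range n, w j) / gridSize w κ n 1 := by ring
        _ ≤ 2 * R / κ := by
            rw [div_le_div_iff₀ (hN 1) hκ]
            nlinarith [(lt_gridSize_one w κ n).le]
    linarith

/-- The cyclic case: one vector per cell suffices, and the rank is the number of cells. -/
lemma quasicentralModulus_le_of_isCyclicVector [Nontrivial H] (hpos : ∀ j, 0 < w j)
    (hanti : Antitone w) (hlim : Tendsto w atTop (𝓝 0)) (hsum : ¬ Summable w)
    (hτ : IsCommutingHermitian τ) {ξ : H} (hξ : IsCyclicVector τ ξ) {R : ℝ} (hR : ‖τ‖ < R) :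
    quasicentralModulus (lorentzPair w) τ ≤ ENNReal.ofReal (16 * R) := by
  have hR0 : 0 < R := (norm_nonneg τ).trans_lt hR
  -- With `κ = 1 / 4` the grid has at most `n / 4` cells.
  have hκ : (0 : ℝ) < 1 / 4 := by norm_num
  choose P hP hPr hPτ hPξ using fun n => exists_gridProjection hτ hR0
    (gridSize_pos w (1 / 4) n) Finset.univ (Submodule.span ℂ {ξ})
  have hfix : ∀ n, (1 - P n) ξ = 0 := by
    intro n
    have h1 := hPξ n ξ (Submodule.mem_span_singleton_self ξ)
    have h2 : (scalarSpectralMeasure τ ξ).real (Metric.ball 0 R)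
        ≤ (scalarSpectralMeasure τ ξ).real
          (⋃ p ∈ Finset.univ, cell R (gridSize w (1 / 4) n) p) := by
      refine measureReal_mono (fun x hx => ?_) (measure_ne_top _ _)
      obtain ⟨p, hp⟩ := exists_mem_cell hR0 (gridSize_pos w (1 / 4) n) hx
      exact Set.mem_biUnion (Finset.mem_univ p) hp
    have h3 := norm_sq_le_measureReal_ball hτ hR ξ
    have h4 : ‖(1 - P n) ξ‖ ^ 2 ≤ 0 := by linarith
    simpa using le_antisymm h4 (sq_nonneg _)
  have hcomm : ∀ j, Tendsto (fun n => ‖τ j * P n - P n * τ j‖) atTop (𝓝 0) := by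
    intro j
    refine squeeze_zero (fun _ => norm_nonneg _) (fun n => hPτ n j) ?_
    simpa using (tendsto_div_gridSize hpos hlim hsum hκ R j).const_mul 2
  have hstrong := tendsto_of_isCyclicVector hξ hP hcomm hfix
  refine quasicentralModulus_le fun A₀ => ?_
  have := A₀.2.2.2
  set K := LinearMap.range (A₀.1 : H →ₗ[ℂ] H)
  set m := 4 * Module.finrank ℂ K
  obtain ⟨M, hM, hM0, hM1⟩ := exists_pos_mul_le hpos (c := 8 * R) (by linarith) m
  have hη : Tendsto (fun n => 4 * ‖τ‖ * ‖(1 - P n) * K.starProjection‖) atTop (𝓝 0) := by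
    have h1 : Tendsto (fun n => ∑ i, ‖(1 - P n) (stdOrthonormalBasis ℂ K i : H)‖) atTop (𝓝 0) := by
      simpa using tendsto_finsetSum Finset.univ fun i _ =>
        hstrong (stdOrthonormalBasis ℂ K i : H)
    have h2 := squeeze_zero (fun n => norm_nonneg _)
      (fun n => norm_mul_starProjection_le (1 - P n) K) h1
    simpa using h2.const_mul (4 * ‖τ‖)
  obtain ⟨n, hn1, hn2, hn3⟩ := ((hη.eventually_le_const hM).and
    ((eventually_gridSize_mul_le hpos hlim hsum hκ).and (eventually_ge_atTop (2 * m)))).exists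
  set r := gridSize w (1 / 4) n 0 * gridSize w (1 / 4) n 1 with hr
  have hr0 : 0 < r := Nat.mul_pos (gridSize_pos w _ n 0) (gridSize_pos w _ n 1)
  have hrn : 4 * r ≤ n := by
    have : (4 : ℝ) * r ≤ n := by
      rw [hr]; push_cast; linarith
    exact_mod_cast this
  refine exists_ge_of_gridSize hpos hanti A₀ (K := K) le_rfl (hP n) hκ hR0 hr0 ?_ (hPτ n) le_rfl
    hn1 le_rfl (by omega) (by linarith) (by linarith) (le_of_eq (by ring))
  refine (hPr n).trans ?_
  have h1 : Module.finrank ℂ (Submodule.span ℂ {ξ}) ≤ 1 := by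
    simpa using finrank_span_le_card (R := ℂ) ({ξ} : Set H)
  have h2 : (Finset.univ : Finset (∀ j, Fin (gridSize w (1 / 4) n j))).card = r := by
    rw [Finset.card_univ, Fintype.card_pi, Fin.prod_univ_two]
    simp [hr]
  have h3 : (Finset.univ : Finset (∀ j, Fin (gridSize w (1 / 4) n j))).card
      * Module.finrank ℂ (Submodule.span ℂ {ξ}) ≤ r := by
    rw [h2]; exact (Nat.mul_le_mul_left r h1).trans_eq (mul_one r)
  exact_mod_cast h3

/-- Finitely many vectors are almost carried, spectrally, by a single compact null set. -/
lemma HasSingularSpectralMeasure.exists_isCompact (hsing : HasSingularSpectralMeasure τ)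
    {ι : Type*} [Finite ι] (b : ι → H) {ε : ℝ} (hε : 0 < ε) :
    ∃ L : Set (Fin 2 → ℝ), IsCompact L ∧ volume L = 0 ∧
      ∀ i, (scalarSpectralMeasure τ (b i)).real Lᶜ ≤ ε := by
  obtain ⟨Z, hZ, hZ0, hμ⟩ := hsing
  have hex : ∀ i, ∃ L ⊆ Z, IsCompact L ∧ scalarSpectralMeasure τ (b i) (Z \ L)
      < ENNReal.ofReal ε := fun i =>
    hZ.exists_isCompact_sdiff_lt (measure_ne_top _ _) (by simpa using hε)
  choose L hLZ hL hLε using hex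
  refine ⟨⋃ i, L i, isCompact_iUnion hL, measure_mono_null (Set.iUnion_subset hLZ) hZ0,
    fun i => ?_⟩
  refine ENNReal.toReal_le_of_le_ofReal hε.le ?_
  calc scalarSpectralMeasure τ (b i) (⋃ i, L i)ᶜ
      ≤ scalarSpectralMeasure τ (b i) (Zᶜ ∪ (Z \ L i)) := by
        refine measure_mono fun x hx => ?_
        by_cases hxZ : x ∈ Z
        · exact Or.inr ⟨hxZ, fun h => hx (Set.mem_iUnion_of_mem i h)⟩
        · exact Or.inl hxZ
    _ ≤ scalarSpectralMeasure τ (b i) Zᶜ + scalarSpectralMeasure τ (b i) (Z \ L i) :=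
        measure_union_le _ _
    _ ≤ ENNReal.ofReal ε := by rw [hμ, zero_add]; exact (hLε i).le

/-- The number of cells meeting a compact null set is negligible compared with the number of
all cells. -/
lemma eventually_card_cell_le (hpos : ∀ j, 0 < w j) (hlim : Tendsto w atTop (𝓝 0))
    (hsum : ¬ Summable w) {κ R : ℝ} (hκ : 0 < κ) (hR : 0 < R) {L : Set (Fin 2 → ℝ)}
    (hL : IsCompact L) (hL0 : volume L = 0) {ε : ℝ} (hε : 0 < ε) :
    ∀ᶠ n : ℕ in atTop, ∀ S : Finset (∀ j, Fin (gridSize w κ n j)),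
      (∀ p ∈ S, (cell R (gridSize w κ n) p ∩ L).Nonempty) → (S.card : ℝ) ≤ ε * n := by
  set d : ℕ → ℝ := fun n => 2 * R / gridSize w κ n 0 + 2 * R / gridSize w κ n 1
  have hd : Tendsto d atTop (𝓝 0) := by
    simpa using (tendsto_div_gridSize hpos hlim hsum hκ (2 * R) 0).add
      (tendsto_div_gridSize hpos hlim hsum hκ (2 * R) 1)
  have hvol : Tendsto (fun n => volume (Metric.cthickening (d n) L)) atTop (𝓝 0) := by
    have := (tendsto_measure_cthickening_of_isCompact (μ := volume) hL).comp hd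
    rwa [hL0] at this
  set ε' : ℝ := ε * R ^ 2 / κ ^ 2
  have hε' : 0 < ε' := by positivity
  filter_upwards [hvol.eventually_le_const (ENNReal.ofReal_pos.2 hε'),
    eventually_gridSize_mul_le hpos hlim hsum hκ] with n h1 h2 S hS
  have hN : ∀ j, (0 : ℝ) < gridSize w κ n j := fun j => by exact_mod_cast gridSize_pos w κ n j
  have h3 := (card_mul_le_volume_cthickening hR (gridSize_pos w κ n) hS).trans h1
  rw [← ENNReal.ofReal_mul (div_nonneg (by linarith) (hN 0).le), ← ENNReal.ofReal_natCast,
    ← ENNReal.ofReal_mul (Nat.cast_nonneg _), ENNReal.ofReal_le_ofReal_iff hε'.le] at h3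
  have hN01 := mul_pos (hN 0) (hN 1)
  have h4 : (S.card : ℝ) * (2 * R / gridSize w κ n 0 * (2 * R / gridSize w κ n 1))
      = S.card * (4 * R ^ 2) / (gridSize w κ n 0 * gridSize w κ n 1) := by
    field_simp; ring
  rw [h4, div_le_iff₀ hN01] at h3
  have h5 : (S.card : ℝ) * (4 * R ^ 2) ≤ ε * n * (4 * R ^ 2) := by
    refine h3.trans ((mul_le_mul_of_nonneg_left h2 hε'.le).trans (le_of_eq ?_))
    simp only [ε']
    field_simp
  exact le_of_mul_le_mul_right h5 (by positivity)

/-- The singular case: several vectors per cell, but only for the few cells meeting a compact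
null set that almost carries these vectors. -/
lemma quasicentralModulus_le_of_hasSingularSpectralMeasure [Nontrivial H] (hpos : ∀ j, 0 < w j)
    (hanti : Antitone w) (hlim : Tendsto w atTop (𝓝 0)) (hsum : ¬ Summable w)
    (hτ : IsCommutingHermitian τ) (hsing : HasSingularSpectralMeasure τ) {c : ℝ} (hc : 0 < c) :
    quasicentralModulus (lorentzPair w) τ ≤ ENNReal.ofReal c := by
  classical
  set R := ‖τ‖ + 1
  have hRτ : ‖τ‖ < R := lt_add_one _
  have hR : 0 < R := (norm_nonneg τ).trans_lt hRτ
  refine quasicentralModulus_le fun A₀ => ?_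
  have := A₀.2.2.2
  set K := LinearMap.range (A₀.1 : H →ₗ[ℂ] H)
  set k := Module.finrank ℂ K with hk
  set b := stdOrthonormalBasis ℂ K
  obtain ⟨M, hM, hM0, hM1⟩ := exists_pos_mul_le hpos (c := c / 2) (by linarith) (4 * k)
  set ε : ℝ := M / ((4 * ‖τ‖ + 1) * (k + 1))
  have hε : 0 < ε := by positivity
  obtain ⟨L, hL, hL0, hLε⟩ := hsing.exists_isCompact (fun i => (b i : H)) (sq_pos_of_pos hε)
  -- A fine grid: the factor `κ` makes the bound `2 R / κ` for the commutators equal to `c / 2`.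
  set κ : ℝ := 4 * R / c
  have hκ : 0 < κ := by positivity
  obtain ⟨n, hn1, hn2⟩ := ((eventually_card_cell_le hpos hlim hsum hκ hR hL hL0
    (ε := 1 / (4 * (k + 1))) (by positivity)).and
    (eventually_ge_atTop (2 * (4 * k + 2)))).exists
  set S : Finset (∀ j, Fin (gridSize w κ n j)) :=
    Finset.univ.filter fun p => (cell R (gridSize w κ n) p ∩ L).Nonempty
  obtain ⟨P, hP, hPr, hPτ, hPξ⟩ := exists_gridProjection hτ hR (gridSize_pos w κ n) S K
  have hSn : 4 * (S.card * k) ≤ n := by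
    have h1 := hn1 S fun p hp => (Finset.mem_filter.1 hp).2
    rw [one_div, inv_mul_eq_div, le_div_iff₀ (by positivity)] at h1
    have h2 : (4 : ℝ) * (S.card * k) ≤ n := by
      have : (0 : ℝ) ≤ S.card := Nat.cast_nonneg _
      linarith
    exact_mod_cast h2
  have hb : ∀ i, ‖(1 - P) (b i : H)‖ ≤ ε := by
    intro i
    set μ := scalarSpectralMeasure τ (b i : H)
    have h1 := hPξ (b i) (b i).2
    have h2 : μ.real (Metric.ball 0 R)
        ≤ μ.real (⋃ p ∈ S, cell R (gridSize w κ n) p) + μ.real Lᶜ := by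
      refine (measureReal_mono fun x hx => ?_).trans (measureReal_union_le _ _)
      by_cases hxL : x ∈ L
      · obtain ⟨p, hp⟩ := exists_mem_cell hR (gridSize_pos w κ n) hx
        exact Or.inl (Set.mem_biUnion
          (Finset.mem_filter.2 ⟨Finset.mem_univ p, x, hp, hxL⟩) hp)
      · exact Or.inr hxL
    have h3 := norm_sq_le_measureReal_ball hτ hRτ (b i : H)
    have h4 : μ.real Lᶜ ≤ ε ^ 2 := hLε i
    refine (sq_le_sq₀ (norm_nonneg _) hε.le).1 ?_
    linarith
  have hη : ‖(1 - P) * K.starProjection‖ ≤ k * ε := by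
    refine (norm_mul_starProjection_le (1 - P) K).trans ?_
    refine (Finset.sum_le_card_nsmul _ _ ε fun i _ => hb i).trans (le_of_eq ?_)
    simp [hk]
  have hMη : 4 * ‖τ‖ * (k * ε) ≤ M := by
    have h1 : M = (4 * ‖τ‖ + 1) * ((k + 1) * ε) := by
      simp only [ε]; field_simp
    rw [h1]
    have := norm_nonneg τ
    gcongr <;> linarith
  refine exists_ge_of_gridSize hpos hanti A₀ (K := K) le_rfl hP hκ hR (Nat.succ_pos (S.card * k))
    ?_ hPτ hη hMη le_rfl (by omega) hM0 hM1 (le_of_eq ?_)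
  · refine hPr.trans ?_
    exact_mod_cast Nat.le_succ _
  · simp only [κ]
    field_simp
    ring

end Modulus

end HybridPerturbation

end

theorem mainTheorem6 (w : ℕ → ℝ) (hpos : ∀ j, 0 < w j) (hanti : Antitone w)
    (hlim : Filter.Tendsto w Filter.atTop (nhds 0)) (hsum : ¬ Summable w) :
    ∃ C : ℝ, ∀ (H : Type u) [NormedAddCommGroup H] [InnerProductSpace ℂ H] [CompleteSpace H]
      [TopologicalSpace.SeparableSpace H], ¬ FiniteDimensional ℂ H →
      ∀ τ : Fin 2 → H →L[ℂ] H, HybridPerturbation.IsCommutingHermitian τ →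
        ((∃ ξ : H, HybridPerturbation.IsCyclicVector τ ξ) →
          HybridPerturbation.quasicentralModulus (HybridPerturbation.lorentzPair w) τ
            ≤ ENNReal.ofReal (C * ‖τ‖)) ∧
        (HybridPerturbation.HasSingularSpectralMeasure τ →
          HybridPerturbation.quasicentralModulus (HybridPerturbation.lorentzPair w) τ = 0) := by
  refine ⟨16, fun H _ _ _ _ hH τ hτ => ?_⟩
  have : Nontrivial H := by
    by_contra h
    rw [not_nontrivial_iff_subsingleton] at h
    exact hH inferInstance
  refine ⟨fun ⟨ξ, hξ⟩ => ?_, fun hsing => ?_⟩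
  · have hcont : Filter.Tendsto (fun R : ℝ => ENNReal.ofReal (16 * R))
        (nhdsWithin ‖τ‖ (Set.Ioi ‖τ‖))
        (nhds (ENNReal.ofReal (16 * ‖τ‖))) :=
      (ENNReal.continuous_ofReal.comp (continuous_const.mul continuous_id)).continuousWithinAt
    refine ge_of_tendsto hcont ?_
    filter_upwards [self_mem_nhdsWithin] with R hR
    exact HybridPerturbation.quasicentralModulus_le_of_isCyclicVector hpos hanti hlim hsum hτ hξ hR
  · have hcont : Filter.Tendsto ENNReal.ofReal (nhdsWithin 0 (Set.Ioi 0)) (nhds 0) := by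
      have := ENNReal.continuous_ofReal.continuousWithinAt (s := Set.Ioi 0) (x := 0)
      rwa [ContinuousWithinAt, ENNReal.ofReal_zero] at this
    refine le_antisymm (ge_of_tendsto hcont ?_) zero_le
    filter_upwards [self_mem_nhdsWithin] with c hc
    exact HybridPerturbation.quasicentralModulus_le_of_hasSingularSpectralMeasure hpos hanti hlim
      hsum hτ hsing hc
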